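/- For $R>0$ let $\mu_{\mathrm{sc},R}$ be the semicircle distribution of radius $R$, i.e. the probability measure on $\mathbb{R}$ with density $\frac{2}{\pi R^2}\sqrt{R^2-x^2}$ on $[-R,R]$ and $0$ elsewhere, and for $t>0$ let $\mathrm{Unif}_{[-t,0]}$ be the uniform distribution on $[-t,0]$. Let $\boxplus$ denote free additive convolution: for compactly supported probability measures $\mu,\nu$ on $\mathbb{R}$, $\mu\boxplus\nu$ is the distribution of $a+b$, where $a$ and $b$ are freely independent self-adjoint elements, with distributions $\mu$ and $\nu$, of some $C^*$-probability space. Let $s(n,k)$ be the signed Stirling numbers of the first kind, defined by $\prod_{i=0}^{n-1}(x+i)=\sum_{k=0}^{n}(-1)^{n-k}s(n,k)\,x^k$. Then for every integer $n\ge 0$ and every real $t>0$, the $n$-th moment $$m_n(t):=\int_{\mathbb{R}}x^n\,d\bigl(\mu_{\mathrm{sc},2\sqrt t}\boxplus\mathrm{Unif}_{[-t,0]}\bigr)(x)$$ exists and equals $$m_n(t)=n!\sum_{j=\lceil n/2\rceil}^{n}\frac{t^j}{j!\,(1+j)!}\,s(1+j,\,n+1-j).$$ -/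

import Mathlib

namespace FreeProbability

open MeasureTheory

/-- `φ` is a state on the unital C⋆-algebra `A`: a positive linear functional with `φ 1 = 1`.
A pair `(A, φ)` of this kind is a C⋆-probability space. -/
structure IsState {A : Type*} [CStarAlgebra A] (φ : A →ₗ[ℂ] ℂ) : Prop where
  map_one : φ 1 = 1
  nonneg_re : ∀ x : A, 0 ≤ (φ (star x * x)).re
  im_eq_zero : ∀ x : A, (φ (star x * x)).im = 0

/-- Free independence (with respect to `φ`) of a family of subalgebras: the expectation of a
nonempty product of centred elements vanishes whenever neighbouring factors come from subalgebras
with different indices. A list entry `(i, x)` is a factor `x` from the `i`-th subalgebra. -/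
def FreeSubalgebras {ι A : Type*} [Ring A] [Algebra ℂ A] (φ : A →ₗ[ℂ] ℂ)
    (B : ι → Subalgebra ℂ A) : Prop :=
  ∀ l : List (ι × A), l ≠ [] → l.IsChain (fun p q => p.1 ≠ q.1) →
    (∀ p ∈ l, p.2 ∈ B p.1 ∧ φ p.2 = 0) → φ ((l.map Prod.snd).prod) = 0

/-- Free independence of two elements: the unital subalgebras they generate are free. (It is used
below for self-adjoint elements, whose unital subalgebras are closed under the involution.) -/
def FreelyIndependent {A : Type*} [Ring A] [Algebra ℂ A] (φ : A →ₗ[ℂ] ℂ) (a b : A) : Prop :=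
  FreeSubalgebras φ (fun i : Bool => Algebra.adjoin ℂ {if i then a else b})

/-- `μ` is the (analytic) distribution of the self-adjoint element `a` with respect to `φ`: the
compactly supported probability measure on `ℝ` whose moments are the moments of `a`. -/
structure IsDistribution {A : Type*} [Ring A] [Algebra ℂ A] (φ : A →ₗ[ℂ] ℂ) (a : A)
    (μ : Measure ℝ) : Prop where
  isProbabilityMeasure : IsProbabilityMeasure μ
  compactSupport : ∃ K : Set ℝ, IsCompact K ∧ μ Kᶜ = 0
  moment : ∀ k : ℕ, φ (a ^ k) = ((∫ x : ℝ, x ^ k ∂μ : ℝ) : ℂ)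

/-- `ρ` is the distribution of `a + b`, where `a` and `b` are freely independent self-adjoint
elements, with distributions `μ` and `ν`, of some C⋆-probability space. -/
def IsFreeAdditiveConvolution (μ ν ρ : Measure ℝ) : Prop :=
  ∃ (A : Type) (_ : CStarAlgebra A) (φ : A →ₗ[ℂ] ℂ) (a b : A),
    IsState φ ∧ IsSelfAdjoint a ∧ IsSelfAdjoint b ∧ FreelyIndependent φ a b ∧
      IsDistribution φ a μ ∧ IsDistribution φ b ν ∧ IsDistribution φ (a + b) ρ

open Classical in
/-- The free additive convolution of two compactly supported probability measures on `ℝ` (and the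
zero measure if there is no measure with the defining property). -/
noncomputable def freeAdditiveConvolution (μ ν : Measure ℝ) : Measure ℝ :=
  if h : ∃ ρ : Measure ℝ, IsFreeAdditiveConvolution μ ν ρ then h.choose else 0

/-- The semicircle distribution of radius `R > 0` centred at `0`: its density is
`2 / (π R²) * √(R² - x²)` on `[-R, R]`, and `0` outside, where the square root below vanishes. -/
noncomputable def semicircle (R : ℝ) : Measure ℝ :=
  volume.withDensity
    (fun x => ENNReal.ofReal (2 / (Real.pi * R ^ 2) * Real.sqrt (R ^ 2 - x ^ 2)))

/-- The uniform distribution on the interval `[a, b]`, for `a < b`. -/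
noncomputable def uniformInterval (a b : ℝ) : Measure ℝ :=
  ProbabilityTheory.cond volume (Set.Icc a b)

/-- The signed Stirling numbers of the first kind: `(-1) ^ (n - k) * s(n, k)` is the coefficient of
`x ^ k` in the rising factorial `x (x + 1) ⋯ (x + n - 1)`. -/
noncomputable def signedStirlingFirst (n k : ℕ) : ℤ :=
  (-1) ^ (n + k) * (ascPochhammer ℤ n).coeff k

end FreeProbability

/-! The proof is the R-transform carried out with formal power series. A series `h` with constant
term 1 encodes the law of `a` when the state sends `(h - aX)⁻¹` to 1 (`NormalizesResolvent`).
Equivalently, `X / h` is the compositional inverse of `∑ mₙ X^(n+1)`, so `h = 1 + X R(X)` with `R`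
the R-transform. The semicircle law of variance `t` has `h = 1 + t X²`, and the uniform law on `[-t,
0]` has `h = tX / (exp(tX) - 1)`. Freeness makes `h - 1` additive
(`FreelyIndependent.normalizesResolvent_add`), and Lagrange inversion (`NormalizesResolvent.moment`)
then gives `(n+1) mₙ = [Xⁿ] (t X² + tX/(exp(tX) - 1))^(n+1)`. After a binomial expansion, the
coefficients of powers of `tX/(exp(tX) - 1)` supply the Stirling numbers
(`coeff_bernoulliSeries_pow`).

This fixes the moments of every measure that meets the definition. Since `freeAdditiveConvolution`
has the default value 0, such a measure must also be shown to exist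
(`exists_isFreeAdditiveConvolution`). On the full Fock space over two letters the two semicircular
operators are free in the vacuum state. One serves as `a`; the other, passed through `-t` times the
semicircle distribution function, becomes uniform and serves as `b`. The law of `a + b` comes from
Riesz–Markov–Kakutani (`IsState.exists_isDistribution`). -/

namespace FreeProbability

open PowerSeries

/-! ### Lagrange inversion for formal power series. -/

section Lagrange

variable {h D : ℂ⟦X⟧}

/-- Since `h = X / D`, this coefficient is the residue of `D' / D^(k+1)`. For `k > 0` that is the
derivative of `-1 / (k D^k)`, so it has no residue. The proof stays within power series. -/
theorem coeff_pow_mul_derivative (hD : D * h = X) (h0 : constantCoeff h = 1) (k : ℕ) :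
    coeff k (h ^ (k + 1) * d⁄dX ℂ D) = if k = 0 then 1 else 0 := by
  have hd : D * d⁄dX ℂ h + h * d⁄dX ℂ D = 1 := by
    have := congrArg (d⁄dX ℂ) hD
    simpa [Derivation.leibniz, smul_eq_mul] using this
  rcases k with _ | k
  · have := congrArg constantCoeff hd
    have hD0 : constantCoeff D = 0 := by
      have := congrArg constantCoeff hD
      simpa [h0] using this
    simp only [map_add, map_mul, hD0, h0] at this
    simpa [h0] using this
  -- `X d/dX` multiplies the coefficient of index `k + 1` by `k + 1`, so the two terms on the right
  -- cancel there.
  · have e : h ^ (k + 1 + 1) * d⁄dX ℂ D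
        = h ^ (k + 1) - C ((k + 1 : ℂ)⁻¹) * (X * d⁄dX ℂ (h ^ (k + 1))) := by
      rw [derivative_pow, ← hD]
      have hk : (C ((k + 1 : ℂ)⁻¹) : ℂ⟦X⟧) * ((k + 1 : ℕ) : ℂ⟦X⟧) = 1 := by
        have : ((k + 1 : ℕ) : ℂ⟦X⟧) = C (k + 1 : ℂ) := by simp
        rw [this, ← map_mul, inv_mul_cancel₀ (by exact_mod_cast k.succ_ne_zero), map_one]
      have : C ((k + 1 : ℂ)⁻¹) * (D * h * (((k + 1 : ℕ) : ℂ⟦X⟧) * h ^ (k + 1 - 1) * d⁄dX ℂ h))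
          = (C ((k + 1 : ℂ)⁻¹) * ((k + 1 : ℕ) : ℂ⟦X⟧)) * (D * h ^ (k + 1) * d⁄dX ℂ h) := by
        simp only [Nat.add_sub_cancel]; ring
      rw [this, hk]
      linear_combination (h ^ (k + 1)) * hd
    rw [e, map_sub, coeff_C_mul, coeff_succ_X_mul, coeff_derivative]
    have : (k + 1 : ℂ) ≠ 0 := by exact_mod_cast k.succ_ne_zero
    simp only [Nat.add_eq_zero_iff, one_ne_zero, and_false, if_false]
    field_simp
    ring

theorem coeff_eq_zero_of_X_pow_mul {R : Type*} [CommRing R] {f : R⟦X⟧} {N k : ℕ} (hk : k < N) :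
    coeff k (X ^ N * f) = 0 := by
  rw [coeff_X_pow_mul', if_neg (by omega)]

/-- Lagrange inversion: the coefficients of the compositional inverse of `X / h`. -/
theorem lagrange_inversion (hD : D * h = X) (h0 : constantCoeff h = 1) (m : ℕ → ℂ) (N : ℕ)
    (H : ∀ k ≤ N + 1, coeff k (∑ n ∈ Finset.range (N + 1), C (m n) * D ^ (n + 1))
      = if k = 1 then 1 else 0) :
    ((N : ℂ) + 1) * m N = coeff N (h ^ (N + 1)) := by
  set S := ∑ n ∈ Finset.range (N + 1), C (m n) * D ^ (n + 1) with hS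
  have hS' : h ^ (N + 1) * d⁄dX ℂ S = ∑ n ∈ Finset.range (N + 1),
      C ((n + 1 : ℂ) * m n) * (X ^ n * (h ^ (N - n + 1) * d⁄dX ℂ D)) := by
    rw [hS, map_sum, Finset.mul_sum]
    refine Finset.sum_congr rfl fun n hn => ?_
    have hn' : N + 1 = n + (N - n + 1) := by
      have := Finset.mem_range.1 hn; omega
    have e : h ^ (N + 1) = h ^ n * h ^ (N - n + 1) := by rw [← pow_add, ← hn']
    rw [e, Derivation.leibniz, derivative_pow, derivative_C, ← hD]
    simp only [smul_eq_mul, map_mul, map_add, map_one, map_natCast, Nat.cast_add, Nat.cast_one,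
      Nat.add_sub_cancel]
    ring
  -- `H` says `S = X` modulo `X^(N+2)`, hence `S' = 1` modulo `X^(N+1)`, which suffices for the
  -- coefficient of index `N`.
  have h1 : coeff N (h ^ (N + 1) * d⁄dX ℂ S) = coeff N (h ^ (N + 1)) := by
    have : coeff N (h ^ (N + 1) * d⁄dX ℂ S) = coeff N (h ^ (N + 1) * 1) := by
      rw [coeff_mul, coeff_mul]
      refine Finset.sum_congr rfl fun p hp => ?_
      have hp2 : p.2 ≤ N := by
        have := Finset.HasAntidiagonal.mem_antidiagonal.1 hp; omega
      rw [coeff_derivative, H _ (by omega), coeff_one]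
      by_cases h2 : p.2 = 0 <;> simp [h2]
    rw [this, mul_one]
  rw [← h1, hS', map_sum, Finset.sum_range_succ, Finset.sum_eq_zero, zero_add]
  · have := coeff_pow_mul_derivative hD h0 0
    rw [coeff_C_mul, coeff_X_pow_mul', if_pos le_rfl, Nat.sub_self, this, if_pos rfl, mul_one]
  · intro n hn
    have hn' := Finset.mem_range.1 hn
    have := coeff_pow_mul_derivative hD h0 (N - n)
    rw [coeff_C_mul, coeff_X_pow_mul', if_pos hn'.le, this, if_neg (by omega), mul_zero]

end Lagrange

/-! ### Stirling numbers as coefficients of powers of `tX / (exp(tX) - 1)`. -/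

section Stirling

theorem signedStirlingFirst_succ_succ (m k : ℕ) :
    signedStirlingFirst (m + 1) (k + 1)
      = signedStirlingFirst m k - m * signedStirlingFirst m (k + 1) := by
  unfold signedStirlingFirst
  rw [ascPochhammer_succ_right, mul_add, Polynomial.coeff_add, Polynomial.coeff_mul_X,
    ← Polynomial.C_eq_natCast, Polynomial.coeff_mul_C]
  ring

theorem signedStirlingFirst_zero_right {m : ℕ} (hm : m ≠ 0) : signedStirlingFirst m 0 = 0 := by
  unfold signedStirlingFirst
  rw [Polynomial.coeff_zero_eq_eval_zero, ascPochhammer_ne_zero_eval_zero _ hm, mul_zero]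

/-- The power series `(exp (t X) - 1) / (t X)`. -/
noncomputable def expQuotient (t : ℂ) : ℂ⟦X⟧ := mk fun n => t ^ n / (n + 1).factorial

/-- The power series `t X / (exp (t X) - 1)`. -/
noncomputable def bernoulliSeries (t : ℂ) : ℂ⟦X⟧ := (expQuotient t)⁻¹

variable (t : ℂ)

theorem constantCoeff_expQuotient : constantCoeff (expQuotient t) = 1 := by
  rw [← coeff_zero_eq_constantCoeff_apply, expQuotient, coeff_mk]; simp

theorem expQuotient_mul_bernoulliSeries : expQuotient t * bernoulliSeries t = 1 :=
  PowerSeries.mul_inv_cancel _ (by rw [constantCoeff_expQuotient]; exact one_ne_zero)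

theorem constantCoeff_bernoulliSeries : constantCoeff (bernoulliSeries t) = 1 := by
  simp [bernoulliSeries, constantCoeff_expQuotient]

theorem derivative_X_mul_expQuotient :
    d⁄dX ℂ (X * expQuotient t) = 1 + C t * (X * expQuotient t) := by
  ext n
  rw [coeff_derivative, coeff_succ_X_mul, map_add, coeff_C_mul, coeff_one, expQuotient, coeff_mk]
  rcases n with _ | n
  · simp
  · rw [coeff_succ_X_mul, coeff_mk, if_neg n.succ_ne_zero, Nat.factorial_succ (n + 1), zero_add]
    have : ((n + 1).factorial : ℂ) ≠ 0 := by exact_mod_cast Nat.factorial_ne_zero _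
    have h2 : ((n : ℂ) + 1 + 1) ≠ 0 := by exact_mod_cast (n + 1).succ_ne_zero
    push_cast
    field_simp
    ring

/-- A Riccati equation, obtained from `u' = 1 + t u` for `u = X * expQuotient t` by writing the
series as `X / u`. -/
theorem X_mul_derivative_bernoulliSeries :
    X * d⁄dX ℂ (bernoulliSeries t)
      = bernoulliSeries t - bernoulliSeries t ^ 2 - C t * X * bernoulliSeries t := by
  have hEA := expQuotient_mul_bernoulliSeries t
  have h1 : d⁄dX ℂ (X * expQuotient t * bernoulliSeries t) = 1 := by
    rw [mul_assoc, hEA, mul_one, derivative_X]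
  rw [Derivation.leibniz, derivative_X_mul_expQuotient, smul_eq_mul, smul_eq_mul] at h1
  set A := bernoulliSeries t
  set E := expQuotient t
  linear_combination A * h1 - (X * d⁄dX ℂ A + C t * X * A) * hEA

/-- Multiplying the Riccati equation by the `m`-th power of the series expresses the power `m + 2`
through the power `m + 1` and its derivative. On coefficients this is the Stirling recurrence. -/
theorem coeff_bernoulliSeries_pow (m : ℕ) : ∀ i ≤ m,
    coeff i (bernoulliSeries t ^ (m + 1)) = t ^ i * signedStirlingFirst (m + 1) (m + 1 - i)
      * (m - i).factorial / m.factorial := by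
  induction m with
  | zero =>
    intro i hi
    obtain rfl : i = 0 := by omega
    rw [coeff_zero_eq_constantCoeff_apply]
    simp [constantCoeff_bernoulliSeries, signedStirlingFirst]
  | succ m ih =>
    have hrec : bernoulliSeries t ^ (m + 1 + 1) = bernoulliSeries t ^ (m + 1)
        - C t * (X * bernoulliSeries t ^ (m + 1))
        - C ((m + 1 : ℂ)⁻¹) * (X * d⁄dX ℂ (bernoulliSeries t ^ (m + 1))) := by
      have hk : (C ((m + 1 : ℂ)⁻¹) : ℂ⟦X⟧) * ((m + 1 : ℕ) : ℂ⟦X⟧) = 1 := by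
        have : ((m + 1 : ℕ) : ℂ⟦X⟧) = C (m + 1 : ℂ) := by simp
        rw [this, ← map_mul, inv_mul_cancel₀ (by exact_mod_cast m.succ_ne_zero), map_one]
      rw [derivative_pow, Nat.add_sub_cancel]
      linear_combination (bernoulliSeries t ^ m * (X * d⁄dX ℂ (bernoulliSeries t))) * hk
        + bernoulliSeries t ^ m * X_mul_derivative_bernoulliSeries t
    have hm1 : (m + 1 : ℂ) ≠ 0 := by exact_mod_cast m.succ_ne_zero
    have hmf : (m.factorial : ℂ) ≠ 0 := by exact_mod_cast Nat.factorial_ne_zero _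
    intro i hi
    rw [hrec, map_sub, map_sub, coeff_C_mul, coeff_C_mul]
    rcases i with _ | i
    · simp only [coeff_zero_X_mul, mul_zero, sub_zero]
      rw [ih 0 (by omega)]
      have := signedStirlingFirst_succ_succ (m + 1) (m + 1)
      have h0 : signedStirlingFirst (m + 1) (m + 1 + 1) = 0 := by
        unfold signedStirlingFirst
        rw [Polynomial.coeff_eq_zero_of_natDegree_lt, mul_zero]
        rw [ascPochhammer_natDegree]; omega
      rw [h0, mul_zero, sub_zero] at this
      simp only [Nat.sub_zero, this]
      have : ((m+1).factorial : ℂ) ≠ 0 := by exact_mod_cast Nat.factorial_ne_zero _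
      field_simp
    · rw [coeff_succ_X_mul, coeff_succ_X_mul, coeff_derivative, ih i (by omega)]
      obtain ⟨r, rfl⟩ : ∃ r, m = i + r := ⟨m - i, by omega⟩
      have hs := signedStirlingFirst_succ_succ (i + r + 1) r
      have e1 : i + r + 1 + 1 - (i + 1) = r + 1 := by omega
      have e2 : i + r + 1 - i = r + 1 := by omega
      have e3 : i + r + 1 - (i + 1) = r := by omega
      have e4 : i + r - i = r := by omega
      rw [e1, e2, e3, e4, hs]
      -- For `r = 0` the coefficient of index `i + 1` is beyond the reach of `ih`, but its total
      -- factor `1 - (i+1)/(m+1)` is zero.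
      rcases r with _ | r
      · rw [signedStirlingFirst_zero_right (by omega)]
        simp only [Nat.add_zero] at *
        rw [Nat.factorial_succ i]
        push_cast
        field_simp
        ring
      · rw [ih (i + 1) (by omega)]
        have e5 : i + (r + 1) + 1 - (i + 1) = r + 1 := by omega
        have e6 : i + (r + 1) - (i + 1) = r := by omega
        rw [e5, e6, Nat.factorial_succ (i + (r + 1)), Nat.factorial_succ r]
        push_cast at *
        field_simp
        ring

end Stirling

/-! ### Binomial expansion of the combined series. -/

section Coefficients

/-- The term with `k` factors `t X²` contributes only if `2k ≤ n`; the substitution `j = n - k`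
turns this into `j ≥ n/2`. -/
theorem coeff_semicircle_add_bernoulliSeries_pow (t : ℂ) (n : ℕ) :
    coeff n ((C t * X ^ 2 + bernoulliSeries t) ^ (n + 1)) =
      ((n + 1).factorial : ℂ) * ∑ j ∈ Finset.Icc ⌈(n : ℚ) / 2⌉₊ n,
        t ^ j / ((j.factorial : ℂ) * ((1 + j).factorial : ℂ)) *
          (signedStirlingFirst (1 + j) (n + 1 - j) : ℂ) := by
  have hterm : ∀ k ∈ Finset.range (n + 1 + 1),
      coeff n ((C t * X ^ 2) ^ k * bernoulliSeries t ^ (n + 1 - k) * ((n + 1).choose k : ℂ⟦X⟧))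
        = if 2 * k ≤ n then ((n + 1).factorial : ℂ) *
            (t ^ (n - k) / (((n - k).factorial : ℂ) * ((1 + (n - k)).factorial : ℂ)) *
            (signedStirlingFirst (1 + (n - k)) (n + 1 - (n - k)) : ℂ)) else 0 := by
    intro k _
    have e : (C t * X ^ 2) ^ k * bernoulliSeries t ^ (n + 1 - k) * ((n + 1).choose k : ℂ⟦X⟧)
        = C (t ^ k * ((n + 1).choose k : ℂ)) *
          (X ^ (2 * k) * bernoulliSeries t ^ (n + 1 - k)) := by
      rw [map_mul, map_pow, map_natCast, mul_pow, ← pow_mul]; ring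
    rw [e, coeff_C_mul, coeff_X_pow_mul']
    split_ifs with hk
    · obtain ⟨r, rfl⟩ : ∃ r, n = 2 * k + r := ⟨n - 2 * k, by omega⟩
      have e1 : 2 * k + r - 2 * k = r := by omega
      have e2 : 2 * k + r + 1 - k = k + r + 1 := by omega
      have e3 : 2 * k + r - k = k + r := by omega
      have e4 : k + r + 1 - r = k + 1 := by omega
      have e5 : 2 * k + r + 1 - (k + r) = k + 1 := by omega
      have e6 : k + r - r = k := by omega
      rw [e1, e2, e3, e5, coeff_bernoulliSeries_pow t _ _ (by omega), e4, e6,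
        Nat.cast_choose ℂ (by omega : k ≤ 2 * k + r + 1), e2, add_comm 1 (k + r)]
      have h1 : ((k + r).factorial : ℂ) ≠ 0 := by exact_mod_cast Nat.factorial_ne_zero _
      have h2 : ((k + r + 1).factorial : ℂ) ≠ 0 := by exact_mod_cast Nat.factorial_ne_zero _
      have h3 : (k.factorial : ℂ) ≠ 0 := by exact_mod_cast Nat.factorial_ne_zero _
      field_simp
      ring
    · rw [mul_zero]
  rw [add_pow, map_sum, Finset.sum_congr rfl hterm, ← Finset.sum_filter, Finset.mul_sum]
  have hceil : ∀ j : ℕ, ⌈(n : ℚ) / 2⌉₊ ≤ j ↔ n ≤ 2 * j := by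
    intro j
    rw [Nat.ceil_le, div_le_iff₀ (by norm_num)]
    constructor
    · intro h
      have : (n : ℚ) ≤ ((2 * j : ℕ) : ℚ) := by push_cast; linarith
      exact_mod_cast this
    · intro h
      have : (n : ℚ) ≤ ((2 * j : ℕ) : ℚ) := by exact_mod_cast h
      push_cast at this; linarith
  refine Finset.sum_nbij' (fun k => n - k) (fun j => n - j) ?_ ?_ ?_ ?_ ?_
  · intro k hk
    simp only [Finset.mem_filter, Finset.mem_range, Finset.mem_Icc, hceil] at hk ⊢
    omega
  · intro k hk
    simp only [Finset.mem_filter, Finset.mem_range, Finset.mem_Icc, hceil] at hk ⊢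
    omega
  · intro k hk
    simp only [Finset.mem_filter, Finset.mem_range] at hk
    omega
  · intro k hk
    simp only [Finset.mem_Icc, hceil] at hk
    omega
  · intro k _
    rfl

end Coefficients

/-! ### Resolvents, moment series and the two R-transforms. -/

section Resolvent

/-- The power series `h - T X` whose coefficients are polynomials in `T`. -/
noncomputable def pencil (h : ℂ⟦X⟧) : (Polynomial ℂ)⟦X⟧ :=
  PowerSeries.map Polynomial.C h - X * C Polynomial.X

/-- The inverse of `h - T X`, for a power series `h` with constant coefficient `1`. -/
noncomputable def resolvent (h : ℂ⟦X⟧) : (Polynomial ℂ)⟦X⟧ := invOfUnit (pencil h) 1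

variable {h : ℂ⟦X⟧}

theorem constantCoeff_pencil (h0 : constantCoeff h = 1) :
    constantCoeff (pencil h) = ((1 : (Polynomial ℂ)ˣ) : Polynomial ℂ) := by
  have h0' : coeff 0 h = 1 := by rw [coeff_zero_eq_constantCoeff_apply, h0]
  rw [← coeff_zero_eq_constantCoeff_apply, pencil, map_sub, coeff_map, coeff_zero_X_mul, h0']
  simp

theorem pencil_mul_resolvent (h0 : constantCoeff h = 1) : pencil h * resolvent h = 1 :=
  mul_invOfUnit _ _ (constantCoeff_pencil h0)

theorem resolvent_unique (h0 : constantCoeff h = 1) {Y : (Polynomial ℂ)⟦X⟧}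
    (hY : pencil h * Y = 1) : Y = resolvent h := by
  have := pencil_mul_resolvent h0
  calc Y = (resolvent h * pencil h) * Y := by rw [mul_comm (resolvent h), this, one_mul]
    _ = resolvent h := by rw [mul_assoc, hY, mul_one]

theorem coeff_zero_resolvent : coeff 0 (resolvent h) = 1 := by
  rw [coeff_zero_eq_constantCoeff_apply, resolvent, constantCoeff_invOfUnit]; simp

/-- With `D = X / h`, the series `X (h - TX)⁻¹` equals `D / (1 - TD)`. The geometric series may be
truncated because `D^(N+2)` is divisible by `X^(N+2)`. -/
theorem coeff_X_mul_resolvent (h0 : constantCoeff h = 1) {D : ℂ⟦X⟧} (hD : D * h = X) {N k : ℕ}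
    (hk : k ≤ N + 1) :
    coeff k (X * resolvent h)
      = ∑ n ∈ Finset.range (N + 1), Polynomial.C (coeff k (D ^ (n + 1))) * Polynomial.X ^ n := by
  set Y := resolvent h with hYdef
  set D' := PowerSeries.map Polynomial.C D with hD'def
  set T : (Polynomial ℂ)⟦X⟧ := C Polynomial.X with hT
  have hY : pencil h * Y = 1 := pencil_mul_resolvent h0
  have hD' : D' * PowerSeries.map Polynomial.C h = X := by
    rw [hD'def, ← map_mul, hD, map_X]
  have hDX : D = X * h⁻¹ := by
    have hne : constantCoeff h ≠ 0 := by rw [h0]; exact one_ne_zero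
    rw [PowerSeries.eq_mul_inv_iff_mul_eq hne, hD]
  have h1 : (1 - T * D') * (X * Y) = D' := by
    rw [pencil] at hY
    linear_combination D' * hY - Y * hD'
  have h2 : ∑ n ∈ Finset.range (N + 1), T ^ n * D' ^ (n + 1)
      = X * Y - X ^ (N + 2) * (T ^ (N + 1) * PowerSeries.map Polynomial.C (h⁻¹) ^ (N + 1) * Y) := by
    have hg := geom_sum_mul_neg (T * D') (N + 1)
    have e : ∑ n ∈ Finset.range (N + 1), T ^ n * D' ^ (n + 1)
        = (∑ n ∈ Finset.range (N + 1), (T * D') ^ n) * D' := by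
      rw [Finset.sum_mul]
      exact Finset.sum_congr rfl fun n _ => by ring
    have e2 : D' ^ (N + 1) = X ^ (N + 1) * PowerSeries.map Polynomial.C (h⁻¹) ^ (N + 1) := by
      rw [hD'def, hDX, map_mul, map_X, mul_pow]
    rw [e]
    calc _ = (∑ n ∈ Finset.range (N + 1), (T * D') ^ n) * (1 - T * D') * (X * Y) := by
          rw [mul_assoc, h1]
      _ = _ := by rw [hg, mul_pow, e2]; ring
  have h3 := congrArg (coeff k) h2
  rw [map_sub, coeff_eq_zero_of_X_pow_mul (by omega), sub_zero] at h3
  rw [← h3, map_sum]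
  refine Finset.sum_congr rfl fun n _ => ?_
  rw [hT, ← map_pow, coeff_C_mul, hD'def, ← map_pow, coeff_map, mul_comm]

theorem coeff_sum_moments (h0 : constantCoeff h = 1) {D : ℂ⟦X⟧} (hD : D * h = X)
    (ℓ : Polynomial ℂ →ₗ[ℂ] ℂ) {N k : ℕ} (hk : k ≤ N + 1) :
    coeff k (∑ n ∈ Finset.range (N + 1), C (ℓ (Polynomial.X ^ n)) * D ^ (n + 1))
      = ℓ (coeff k (X * resolvent h)) := by
  rw [coeff_X_mul_resolvent h0 hD hk, map_sum, map_sum]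
  refine Finset.sum_congr rfl fun n _ => ?_
  rw [coeff_C_mul, ← Polynomial.smul_eq_C_mul, map_smul, smul_eq_mul, mul_comm]

/-- The functional `ℓ` maps the resolvent `(h - T X)⁻¹` to `1`. -/
def NormalizesResolvent (ℓ : Polynomial ℂ →ₗ[ℂ] ℂ) (h : ℂ⟦X⟧) : Prop :=
  ∀ k, ℓ (coeff k (resolvent h)) = if k = 0 then 1 else 0

theorem NormalizesResolvent.moment (h0 : constantCoeff h = 1) {ℓ : Polynomial ℂ →ₗ[ℂ] ℂ}
    (H : NormalizesResolvent ℓ h) (N : ℕ) :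
    ((N : ℂ) + 1) * ℓ (Polynomial.X ^ N) = coeff N (h ^ (N + 1)) := by
  have hne : constantCoeff h ≠ 0 := by rw [h0]; exact one_ne_zero
  have hD : (X * h⁻¹) * h = X := by rw [mul_assoc, PowerSeries.inv_mul_cancel _ hne, mul_one]
  refine lagrange_inversion hD h0 (fun n => ℓ (Polynomial.X ^ n)) N fun k hk => ?_
  rw [coeff_sum_moments h0 hD ℓ hk]
  rcases k with _ | k
  · simp
  · rw [coeff_succ_X_mul, H]; simp

/-- The moment series is formally `log(1 + tu) / t`, whose inverse is `D = (exp(tX) - 1) / t`.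
Differentiating avoids the logarithm: `D' = 1 + tD` cancels the geometric series `∑ (-tD)ⁿ` up to a
high power of `X`. -/
theorem normalizesResolvent_uniform (t : ℂ) (ℓ : Polynomial ℂ →ₗ[ℂ] ℂ)
    (hℓ : ∀ n : ℕ, ℓ (Polynomial.X ^ n) = (-t) ^ n / (n + 1)) :
    NormalizesResolvent ℓ (bernoulliSeries t) := by
  set D := X * expQuotient t with hDdef
  have hD : D * bernoulliSeries t = X := by
    rw [hDdef, mul_assoc, expQuotient_mul_bernoulliSeries, mul_one]
  intro k
  rw [← coeff_succ_X_mul, ← coeff_sum_moments (constantCoeff_bernoulliSeries t) hD ℓ le_rfl]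
  set S := ∑ n ∈ Finset.range (k + 1), C (ℓ (Polynomial.X ^ n)) * D ^ (n + 1) with hS
  have hd : d⁄dX ℂ S = 1 - X ^ (k + 1) * (C ((-t) ^ (k + 1)) * expQuotient t ^ (k + 1)) := by
    have e : d⁄dX ℂ S = (∑ n ∈ Finset.range (k + 1), (C (-t) * D) ^ n) * (1 - C (-t) * D) := by
      rw [hS, map_sum, Finset.sum_mul]
      refine Finset.sum_congr rfl fun n _ => ?_
      have hn : (n + 1 : ℂ) ≠ 0 := by exact_mod_cast n.succ_ne_zero
      have hc : C ((-t) ^ n / (n + 1 : ℂ)) * ((n + 1 : ℕ) : ℂ⟦X⟧) = C (-t) ^ n := by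
        have : ((n + 1 : ℕ) : ℂ⟦X⟧) = C (n + 1 : ℂ) := by simp
        rw [this, ← map_mul, div_mul_cancel₀ _ hn, map_pow]
      rw [hℓ, Derivation.leibniz, derivative_pow, derivative_C, Nat.add_sub_cancel,
        derivative_X_mul_expQuotient, smul_eq_mul, smul_zero, add_zero, ← hDdef]
      have hneg : (C (-t) : ℂ⟦X⟧) = -C t := map_neg _ _
      linear_combination D ^ n * (1 + C t * D) * hc + C (-t) ^ n * D ^ (n + 1) * hneg
    rw [e, geom_sum_mul_neg, mul_pow, hDdef, mul_pow, map_pow]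
    ring
  have h1 := congrArg (coeff k) hd
  rw [coeff_derivative, map_sub, coeff_eq_zero_of_X_pow_mul (by omega), coeff_one, sub_zero] at h1
  have hk : (k + 1 : ℂ) ≠ 0 := by exact_mod_cast k.succ_ne_zero
  by_cases hk0 : k = 0
  · subst hk0; simpa using h1
  · rw [if_neg hk0] at h1 ⊢
    exact (mul_eq_zero.1 h1).resolve_right hk

/-- The orthogonal polynomials of the semicircle distribution of variance `t`. -/
noncomputable def semicirclePoly {R : Type*} [CommRing R] (t : R) : ℕ → Polynomial R
  | 0 => 1
  | 1 => Polynomial.X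
  | n + 2 => Polynomial.X * semicirclePoly t (n + 1) - Polynomial.C t * semicirclePoly t n

theorem map_semicirclePoly {R S : Type*} [CommRing R] [CommRing S] (f : R →+* S) (t : R) :
    ∀ n, (semicirclePoly t n).map f = semicirclePoly (f t) n
  | 0 => by simp [semicirclePoly]
  | 1 => by simp [semicirclePoly]
  | n + 2 => by
    rw [semicirclePoly, semicirclePoly, Polynomial.map_sub, Polynomial.map_mul, Polynomial.map_mul,
      map_semicirclePoly f t n, map_semicirclePoly f t (n + 1), Polynomial.map_X, Polynomial.map_C]

/-- The three-term recurrence has generating function `1 / (1 - TX + tX²)`. Normalizing this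
resolvent therefore means that the polynomials of positive degree integrate to zero. -/
theorem coeff_resolvent_semicircle (t : ℂ) (k : ℕ) :
    coeff k (resolvent (1 + C t * X ^ 2)) = semicirclePoly t k := by
  have hY : pencil (1 + C t * X ^ 2) * mk (semicirclePoly t) = 1 := by
    have e : pencil (1 + C t * X ^ 2) * mk (semicirclePoly t) = mk (semicirclePoly t)
        + C (Polynomial.C t) * (X ^ 2 * mk (semicirclePoly t))
        - C Polynomial.X * (X * mk (semicirclePoly t)) := by
      simp only [pencil, map_add, map_mul, map_one, map_pow, map_X, PowerSeries.map_C]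
      ring
    rw [e]
    ext1 k
    rw [map_sub, map_add, coeff_C_mul, coeff_C_mul, coeff_X_pow_mul', coeff_mk, coeff_one]
    rcases k with _ | _ | k
    · simp [semicirclePoly]
    · rw [coeff_succ_X_mul]; simp [semicirclePoly]
    · rw [coeff_succ_X_mul, coeff_mk, coeff_mk, if_pos (by omega)]
      simp [semicirclePoly]
  rw [← resolvent_unique _ hY, coeff_mk]
  simp

end Resolvent

/-! ### Alternating products of centred elements. -/

section AlternatingSpan

variable {ι A : Type*} [Ring A] [Algebra ℂ A] (φ : A →ₗ[ℂ] ℂ) (B : ι → Subalgebra ℂ A)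

/-- The span of the nonempty alternating products of centred elements whose first factor belongs
to the `i`-th subalgebra. -/
def alternatingSpan (i : ι) : Submodule ℂ A :=
  Submodule.span ℂ {z | ∃ (x : A) (l : List (ι × A)),
    ((i, x) :: l).IsChain (fun p q => p.1 ≠ q.1) ∧
    (∀ p ∈ (i, x) :: l, p.2 ∈ B p.1 ∧ φ p.2 = 0) ∧ z = (((i, x) :: l).map Prod.snd).prod}

variable {φ B}

theorem FreeSubalgebras.apply_eq_zero (hfree : FreeSubalgebras φ B) {i : ι} {z : A}
    (hz : z ∈ alternatingSpan φ B i) : φ z = 0 := by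
  induction hz using Submodule.span_induction with
  | mem z hz =>
    obtain ⟨x, l, hc, hB, rfl⟩ := hz
    exact hfree _ (by simp) hc hB
  | zero => exact map_zero φ
  | add x y _ _ hx hy => rw [map_add, hx, hy, add_zero]
  | smul c x _ hx => rw [map_smul, hx, smul_zero]

theorem mem_alternatingSpan {i : ι} {x : A} (hx : x ∈ B i) (h0 : φ x = 0) :
    x ∈ alternatingSpan φ B i := by
  refine Submodule.subset_span ⟨x, [], by simp, ?_, by simp⟩
  simpa using ⟨hx, h0⟩

theorem mul_mem_alternatingSpan {i j : ι} (hij : i ≠ j) {x z : A} (hx : x ∈ B i) (h0 : φ x = 0)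
    (hz : z ∈ alternatingSpan φ B j) : x * z ∈ alternatingSpan φ B i := by
  induction hz using Submodule.span_induction with
  | mem z hz =>
    obtain ⟨y, l, hc, hB, rfl⟩ := hz
    refine Submodule.subset_span ⟨x, (j, y) :: l, ?_, ?_, by simp⟩
    · exact List.isChain_cons_cons.2 ⟨hij, hc⟩
    · intro p hp
      rcases List.mem_cons.1 hp with rfl | hp
      · exact ⟨hx, h0⟩
      · exact hB p hp
  | zero => rw [mul_zero]; exact Submodule.zero_mem _
  | add y z _ _ hy hz => rw [mul_add]; exact Submodule.add_mem _ hy hz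
  | smul c y _ hy => rw [mul_smul_comm]; exact Submodule.smul_mem _ _ hy

/-- The coefficients of a solution of `ω = α + α β + α β ω` are alternating, if those of `α` and
`β` are centred. -/
theorem coeff_mem_alternatingSpan {i j : ι} (hij : i ≠ j) {α β ω : A⟦X⟧}
    (hα : ∀ n, coeff n α ∈ B i ∧ φ (coeff n α) = 0) (hβ : ∀ n, coeff n β ∈ B j ∧ φ (coeff n β) = 0)
    (hα0 : coeff 0 α = 0) (hω : ω = α + α * (β + β * ω)) (n : ℕ) :
    coeff n ω ∈ alternatingSpan φ B i := by
  induction n using Nat.strong_induction_on with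
  | _ n ih =>
    rw [hω, map_add]
    refine Submodule.add_mem _ (mem_alternatingSpan (hα n).1 (hα n).2) ?_
    rw [coeff_mul]
    refine Submodule.sum_mem _ fun p hp => ?_
    have hp := Finset.HasAntidiagonal.mem_antidiagonal.1 hp
    -- As `α` has no constant term, `ω` enters the right-hand side only through coefficients of
    -- index below `n`.
    rcases Nat.eq_zero_or_pos p.1 with h0 | h0
    · rw [h0, hα0, zero_mul]; exact Submodule.zero_mem _
    refine mul_mem_alternatingSpan hij (hα _).1 (hα _).2 ?_
    rw [map_add]
    refine Submodule.add_mem _ (mem_alternatingSpan (hβ _).1 (hβ _).2) ?_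
    rw [coeff_mul]
    refine Submodule.sum_mem _ fun q hq => ?_
    have hq := Finset.HasAntidiagonal.mem_antidiagonal.1 hq
    exact mul_mem_alternatingSpan hij.symm (hβ _).1 (hβ _).2 (ih _ (by omega))

end AlternatingSpan

/-! ### Additivity of the R-transform under freeness. -/

section FreeSum

variable {A : Type*} [Ring A] [Algebra ℂ A]

/-- The resolvent `(h - a X)⁻¹` of an element `a`. -/
noncomputable def resolventAt (h : ℂ⟦X⟧) (a : A) : A⟦X⟧ :=
  PowerSeries.map (Polynomial.aeval a : Polynomial ℂ →ₐ[ℂ] A).toRingHom (resolvent h)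

theorem coeff_resolventAt (h : ℂ⟦X⟧) (a : A) (n : ℕ) :
    coeff n (resolventAt h a) = Polynomial.aeval a (coeff n (resolvent h)) := by
  rw [resolventAt, coeff_map]; rfl

theorem coeff_resolventAt_mem (h : ℂ⟦X⟧) (a : A) (n : ℕ) :
    coeff n (resolventAt h a) ∈ Algebra.adjoin ℂ {a} := by
  rw [coeff_resolventAt]; exact Polynomial.aeval_mem_adjoin_singleton _ _

/-- The power series `h - a X`. -/
noncomputable def pencilAt (h : ℂ⟦X⟧) (a : A) : A⟦X⟧ :=
  PowerSeries.map (algebraMap ℂ A) h - X * C a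

theorem map_pencil (h : ℂ⟦X⟧) (a : A) :
    PowerSeries.map (Polynomial.aeval a : Polynomial ℂ →ₐ[ℂ] A).toRingHom (pencil h)
      = pencilAt h a := by
  rw [pencil, pencilAt, map_sub, map_mul, map_X, PowerSeries.map_C]
  congr 1
  · ext n
    simp
  · simp

theorem pencilAt_mul_resolventAt {h : ℂ⟦X⟧} (h0 : constantCoeff h = 1) (a : A) :
    pencilAt h a * resolventAt h a = 1 := by
  rw [← map_pencil, resolventAt, ← map_mul, pencil_mul_resolvent h0, map_one]

theorem resolventAt_mul_pencilAt {h : ℂ⟦X⟧} (h0 : constantCoeff h = 1) (a : A) :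
    resolventAt h a * pencilAt h a = 1 := by
  rw [← map_pencil, resolventAt, ← map_mul, mul_comm, pencil_mul_resolvent h0, map_one]

/-- The linear functional on polynomials given by the moments of `a`. -/
noncomputable def momentFunctional (φ : A →ₗ[ℂ] ℂ) (a : A) : Polynomial ℂ →ₗ[ℂ] ℂ :=
  φ ∘ₗ (Polynomial.aeval a : Polynomial ℂ →ₐ[ℂ] A).toLinearMap

theorem momentFunctional_X_pow (φ : A →ₗ[ℂ] ℂ) (a : A) (n : ℕ) :
    momentFunctional φ a (Polynomial.X ^ n) = φ (a ^ n) := by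
  simp [momentFunctional]

theorem NormalizesResolvent.coeff_sub_one {φ : A →ₗ[ℂ] ℂ} (hφ : φ 1 = 1) {a : A} {h : ℂ⟦X⟧}
    (H : NormalizesResolvent (momentFunctional φ a) h) (n : ℕ) :
    coeff n (resolventAt h a - 1) ∈ Algebra.adjoin ℂ {a} ∧ φ (coeff n (resolventAt h a - 1)) = 0 := by
  rw [map_sub, coeff_one]
  constructor
  · refine Subalgebra.sub_mem _ (coeff_resolventAt_mem h a n) ?_
    split_ifs
    · exact Subalgebra.one_mem _
    · exact Subalgebra.zero_mem _
  · have hn : φ (coeff n (resolventAt h a)) = if n = 0 then 1 else 0 := by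
      rw [coeff_resolventAt]; exact H n
    rw [map_sub, hn]
    split_ifs
    · rw [hφ, sub_self]
    · rw [map_zero, sub_self]

/-- Additivity of the R-transform: if `f` and `g` normalize the resolvents of the free elements
`a` and `b`, then `f + g - 1` normalizes the resolvent of `a + b`. -/
theorem FreelyIndependent.normalizesResolvent_add {φ : A →ₗ[ℂ] ℂ} (hφ : φ 1 = 1) {a b : A}
    (hfree : FreelyIndependent φ a b) {f g : ℂ⟦X⟧} (hf0 : constantCoeff f = 1)
    (hg0 : constantCoeff g = 1) (hf : NormalizesResolvent (momentFunctional φ a) f)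
    (hg : NormalizesResolvent (momentFunctional φ b) g) :
    NormalizesResolvent (momentFunctional φ (a + b)) (f + g - 1) := by
  have h0 : constantCoeff (f + g - 1) = 1 := by simp [hf0, hg0]
  set U := pencilAt f a with hU
  set V := pencilAt g b with hV
  set α := resolventAt f a - 1 with hα
  set β := resolventAt g b - 1 with hβ
  set Q := resolventAt (f + g - 1) (a + b) with hQ
  have hYa : resolventAt f a * U = 1 := resolventAt_mul_pencilAt hf0 a
  have hVY : V * resolventAt g b = 1 := pencilAt_mul_resolventAt hg0 b
  have hYV : resolventAt g b * V = 1 := resolventAt_mul_pencilAt hg0 b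
  have hUV : (U + V - 1) * Q = 1 := by
    have : U + V - 1 = pencilAt (f + g - 1) (a + b) := by
      simp only [hU, hV, pencilAt, map_add, map_sub, map_one, mul_add]; abel
    rw [this]; exact pencilAt_mul_resolventAt h0 _
  -- With `U⁻¹ = 1 + α` and `V⁻¹ = 1 + β` one finds `(1+α)(U+V-1)(1+β) = 1 - αβ`. Hence `Q =
  -- (1+β)(1+ω)` with `(1 - αβ)(1+ω) = 1+α`, which is the recursion `hrec`.
  set ω := V * Q - 1 with hω
  have hQω : Q = (1 + β) * (1 + ω) := by
    rw [hβ, hω, add_sub_cancel, add_sub_cancel, ← mul_assoc, hYV, one_mul]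
  have hrec : ω = α + α * (β + β * ω) := by
    have e1 : (1 + α) * U = 1 := by rw [hα, add_sub_cancel, hYa]
    have e2 : V * (1 + β) = 1 := by rw [hβ, add_sub_cancel, hVY]
    have e3 : (1 + α) * ((U + V - 1) * Q) = 1 + α := by rw [hUV, mul_one]
    have e4 : (1 + α) * ((U + V - 1) * Q)
        = ((1 + α) * U) * Q + (1 + α) * (V * Q) - (1 + α) * Q := by noncomm_ring
    have e5 : V * Q = 1 + ω := by rw [hω, add_sub_cancel]
    rw [e4, e1, e5, hQω] at e3
    have e6 : 1 * ((1 + β) * (1 + ω)) + (1 + α) * (1 + ω) - (1 + α) * ((1 + β) * (1 + ω))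
        - (1 + α) = ω - (α + α * (β + β * ω)) := by noncomm_ring
    rw [e3, sub_self] at e6
    exact (sub_eq_zero.1 e6.symm)
  set B : Bool → Subalgebra ℂ A := fun i : Bool => Algebra.adjoin ℂ {if i then a else b} with hB
  have hαB : ∀ n, coeff n α ∈ B true ∧ φ (coeff n α) = 0 := hf.coeff_sub_one hφ
  have hβB : ∀ n, coeff n β ∈ B false ∧ φ (coeff n β) = 0 := by
    simpa only [hB, Bool.false_eq_true, if_false] using hg.coeff_sub_one hφ
  have hα0 : coeff 0 α = 0 := by
    rw [hα, map_sub, coeff_resolventAt, coeff_zero_resolvent]; simp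
  have hωB := coeff_mem_alternatingSpan (by decide : true ≠ false) hαB hβB hα0 hrec
  intro k
  have hk : momentFunctional φ (a + b) (coeff k (resolvent (f + g - 1))) = φ (coeff k Q) := by
    rw [hQ, coeff_resolventAt]; rfl
  -- All terms but 1 have coefficients killed by `φ`: those of `β` are centred, and those of `ω` and
  -- `β * ω` are alternating.
  have hQ' : Q = 1 + β + (ω + β * ω) := by rw [hQω]; noncomm_ring
  have hβω : φ (coeff k (β * ω)) = 0 := by
    refine FreeSubalgebras.apply_eq_zero (B := B) (i := false) hfree ?_
    rw [coeff_mul]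
    exact Submodule.sum_mem _ fun p _ =>
      mul_mem_alternatingSpan (by decide) (hβB _).1 (hβB _).2 (hωB _)
  rw [hk, hQ', map_add, map_add, map_add, map_add, map_add, map_add, (hβB k).2, hβω,
    FreeSubalgebras.apply_eq_zero (B := B) hfree (hωB k), coeff_one]
  split_ifs <;> simp [hφ]

/-- The moments of the sum of free elements with a semicircle distribution of variance `t` and the
uniform distribution on `[-t, 0]`. -/
theorem FreelyIndependent.moment_add {φ : A →ₗ[ℂ] ℂ} (hφ : φ 1 = 1) {a b : A}
    (hfree : FreelyIndependent φ a b) (t : ℂ)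
    (ha : ∀ k, momentFunctional φ a (semicirclePoly t k) = if k = 0 then 1 else 0)
    (hb : ∀ n : ℕ, φ (b ^ n) = (-t) ^ n / (n + 1)) (n : ℕ) :
    φ ((a + b) ^ n) = (n.factorial : ℂ) * ∑ j ∈ Finset.Icc ⌈(n : ℚ) / 2⌉₊ n,
        t ^ j / ((j.factorial : ℂ) * ((1 + j).factorial : ℂ)) *
          (signedStirlingFirst (1 + j) (n + 1 - j) : ℂ) := by
  have hf : NormalizesResolvent (momentFunctional φ a) (1 + C t * X ^ 2) := by
    intro k; rw [coeff_resolvent_semicircle, ha]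
  have hg : NormalizesResolvent (momentFunctional φ b) (bernoulliSeries t) :=
    normalizesResolvent_uniform t _ fun n => by rw [momentFunctional_X_pow, hb]
  have hsum := hfree.normalizesResolvent_add hφ (by simp) (constantCoeff_bernoulliSeries t) hf hg
  have e : 1 + C t * X ^ 2 + bernoulliSeries t - 1 = C t * X ^ 2 + bernoulliSeries t := by ring
  rw [e] at hsum
  have hm := hsum.moment (by simp [constantCoeff_bernoulliSeries]) n
  rw [momentFunctional_X_pow, coeff_semicircle_add_bernoulliSeries_pow, Nat.factorial_succ] at hm
  have hn : (n + 1 : ℂ) ≠ 0 := by exact_mod_cast n.succ_ne_zero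
  refine mul_left_cancel₀ hn (hm.trans ?_)
  push_cast
  ring

end FreeSum

end FreeProbability

namespace FreeProbability

open MeasureTheory

/-! ### Existence of the distribution of a self-adjoint element. -/

section Distribution

variable {A : Type*} [CStarAlgebra A] {φ : A →ₗ[ℂ] ℂ}

theorem IsState.im_eq_zero_of_isSelfAdjoint (hφ : IsState φ) {c : A} (hc : IsSelfAdjoint c) :
    (φ c).im = 0 := by
  have h1 := hφ.im_eq_zero (1 + c)
  have h2 := hφ.im_eq_zero c
  rw [hc.star_eq] at h2
  have e : star (1 + c) * (1 + c) = 1 + c + c + c * c := by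
    rw [star_add, star_one, hc.star_eq]; noncomm_ring
  rw [e, map_add, map_add, map_add, hφ.map_one, Complex.add_im, Complex.add_im, Complex.add_im,
    h2, Complex.one_im] at h1
  linarith

/-- Riesz–Markov–Kakutani on the spectrum of `c`, for the functional `f ↦ Re φ(f(c))`. It is
positive because `f ≥ 0` is the square of `√f`. -/
theorem IsState.exists_isDistribution (hφ : IsState φ) {c : A} (hc : IsSelfAdjoint c) :
    ∃ ρ : Measure ℝ, IsDistribution φ c ρ := by
  let X := spectrum ℝ c
  have : CompactSpace X := isCompact_iff_compactSpace.1 (spectrum.isCompact c)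
  let L : CompactlySupportedContinuousMap X ℝ →ₗ[ℝ] ℝ :=
    { toFun := fun f => (φ (cfcHom hc (f : C(X, ℝ)))).re
      map_add' := fun f g => by
        have : ((f + g : CompactlySupportedContinuousMap X ℝ) : C(X, ℝ)) = (f : C(X, ℝ)) + g := rfl
        rw [this, map_add, map_add, Complex.add_re]
      map_smul' := fun r f => by
        have : ((r • f : CompactlySupportedContinuousMap X ℝ) : C(X, ℝ)) = r • (f : C(X, ℝ)) := rfl
        rw [this, map_smul, ← Complex.coe_smul, map_smul]
        simp }
  let Λ : CompactlySupportedContinuousMap X ℝ →ₚ[ℝ] ℝ := PositiveLinearMap.mk₀ L (by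
    intro f hf
    let g : C(X, ℝ) := ⟨fun x => Real.sqrt (f x), by fun_prop⟩
    have hg : (f : C(X, ℝ)) = star g * g := by
      ext x
      exact (Real.mul_self_sqrt (hf x)).symm
    change 0 ≤ (φ (cfcHom hc (f : C(X, ℝ)))).re
    rw [hg, map_mul, map_star]
    exact hφ.nonneg_re _)
  have hΛ : ∀ k : ℕ, ∫ x : X, (x : ℝ) ^ k ∂(RealRMK.rieszMeasure Λ) = (φ (c ^ k)).re := by
    intro k
    let p : C(X, ℝ) := (ContinuousMap.id ℝ).restrict X ^ k
    let p' : CompactlySupportedContinuousMap X ℝ :=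
      ⟨p, HasCompactSupport.of_compactSpace _⟩
    have h1 := RealRMK.integral_rieszMeasure Λ p'
    have h2 : Λ p' = (φ (cfcHom hc p)).re := rfl
    rw [h2, map_pow, cfcHom_id] at h1
    exact h1
  have hprob : IsProbabilityMeasure (RealRMK.rieszMeasure Λ) := by
    have h0 := hΛ 0
    simp only [pow_zero, hφ.map_one, Complex.one_re, integral_const, smul_eq_mul, mul_one] at h0
    rw [measureReal_def] at h0
    constructor
    rw [← ENNReal.toReal_eq_one_iff]
    exact h0
  have hmeas : Measurable (Subtype.val : X → ℝ) := measurable_subtype_coe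
  refine ⟨(RealRMK.rieszMeasure Λ).map Subtype.val, ⟨?_, ?_, ?_⟩⟩
  · exact Measure.isProbabilityMeasure_map hmeas.aemeasurable
  · refine ⟨X, spectrum.isCompact c, ?_⟩
    rw [Measure.map_apply hmeas (spectrum.isCompact c).measurableSet.compl]
    simp [X]
  · intro k
    rw [integral_map hmeas.aemeasurable (by fun_prop), hΛ k]
    apply Complex.ext
    · simp
    · simp [hφ.im_eq_zero_of_isSelfAdjoint (hc.pow k)]

end Distribution

/-! ### Integrability for compactly supported measures. -/

section Integrability

theorem integrable_of_isCompact_of_continuous {μ : Measure ℝ} [IsFiniteMeasure μ] {K : Set ℝ}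
    (hK : IsCompact K) (hμ : μ Kᶜ = 0) {f : ℝ → ℝ} (hf : Continuous f) : Integrable f μ := by
  obtain ⟨M, hM⟩ := hK.exists_bound_of_continuousOn hf.continuousOn
  refine Integrable.of_bound hf.aestronglyMeasurable M ?_
  have : ∀ᵐ x ∂μ, x ∈ K := by
    rw [ae_iff]; exact hμ
  filter_upwards [this] with x hx using hM x hx

end Integrability

/-! ### The semicircle law: orthogonal polynomials and distribution function. -/

section Semicircle

/-- The density of the semicircle distribution of radius `R`. -/
noncomputable def semicircleDensity (R x : ℝ) : ℝ :=
  2 / (Real.pi * R ^ 2) * Real.sqrt (R ^ 2 - x ^ 2)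

theorem continuous_semicircleDensity (R : ℝ) : Continuous (semicircleDensity R) := by
  unfold semicircleDensity; fun_prop

theorem semicircleDensity_nonneg (R x : ℝ) : 0 ≤ semicircleDensity R x := by
  unfold semicircleDensity; positivity

theorem semicircleDensity_eq_zero {R x : ℝ} (hR : 0 ≤ R) (hx : x ∉ Set.Icc (-R) R) :
    semicircleDensity R x = 0 := by
  have : R ^ 2 - x ^ 2 ≤ 0 := by
    rw [sub_nonpos]
    by_contra! h
    exact hx (abs_le.1 (abs_le_of_sq_le_sq h.le hR))
  rw [semicircleDensity, Real.sqrt_eq_zero_of_nonpos this, mul_zero]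

theorem integral_semicircle {R : ℝ} (hR : 0 ≤ R) (f : ℝ → ℝ) :
    ∫ x, f x ∂semicircle R = ∫ x in (-R)..R, semicircleDensity R x * f x := by
  have hm : Measurable fun x => ENNReal.ofReal (semicircleDensity R x) :=
    (continuous_semicircleDensity R).measurable.ennreal_ofReal
  have h1 : ∫ x, f x ∂semicircle R = ∫ x, semicircleDensity R x * f x := by
    change ∫ x, f x ∂(volume.withDensity fun x => ENNReal.ofReal (semicircleDensity R x)) = _
    rw [integral_withDensity_eq_integral_toReal_smul hm (by simp)]
    refine integral_congr_ae (Filter.Eventually.of_forall fun x => ?_)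
    simp [ENNReal.toReal_ofReal (semicircleDensity_nonneg R x)]
  rw [h1, intervalIntegral.integral_of_le (by linarith), ← integral_Icc_eq_integral_Ioc,
    setIntegral_eq_integral_of_forall_compl_eq_zero]
  intro x hx
  rw [semicircleDensity_eq_zero hR hx, zero_mul]

theorem semicircle_compl_Icc {R : ℝ} (hR : 0 ≤ R) : semicircle R (Set.Icc (-R) R)ᶜ = 0 := by
  change volume.withDensity (fun x => ENNReal.ofReal (semicircleDensity R x)) _ = 0
  rw [withDensity_apply _ measurableSet_Icc.compl]
  refine setLIntegral_eq_zero measurableSet_Icc.compl fun x hx => ?_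
  simp [semicircleDensity_eq_zero hR hx]

theorem integral_semicircle_eq_integral_cos {R : ℝ} (hR : 0 < R) {f : ℝ → ℝ} (hf : Continuous f) :
    ∫ x, f x ∂semicircle R
      = 2 / Real.pi * ∫ θ in (0 : ℝ)..Real.pi, f (R * Real.cos θ) * Real.sin θ * Real.sin θ := by
  rw [integral_semicircle hR.le]
  have hsub := intervalIntegral.integral_comp_mul_deriv (a := 0) (b := Real.pi)
    (f := fun θ => R * Real.cos θ) (f' := fun θ => R * -Real.sin θ)
    (g := fun x => semicircleDensity R x * f x)
    (fun x _ => (Real.hasDerivAt_cos x).const_mul R) (by fun_prop)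
    ((continuous_semicircleDensity R).mul hf)
  simp only [Real.cos_zero, Real.cos_pi, mul_one, mul_neg] at hsub
  rw [intervalIntegral.integral_symm, ← hsub, ← intervalIntegral.integral_neg,
    ← intervalIntegral.integral_const_mul]
  refine intervalIntegral.integral_congr fun θ hθ => ?_
  rw [Set.uIcc_of_le Real.pi_pos.le] at hθ
  have hs : 0 ≤ Real.sin θ := Real.sin_nonneg_of_mem_Icc hθ
  have hsq : Real.sqrt (R ^ 2 - (R * Real.cos θ) ^ 2) = R * Real.sin θ := by
    rw [show R ^ 2 - (R * Real.cos θ) ^ 2 = (R * Real.sin θ) ^ 2 by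
      rw [mul_pow, mul_pow, Real.sin_sq]; ring]
    exact Real.sqrt_sq (by positivity)
  simp only [Function.comp_apply, semicircleDensity, hsq]
  have := Real.pi_pos
  field_simp

/-- These are rescaled Chebyshev polynomials of the second kind; the recurrence is the addition
formula for the sine. -/
theorem semicirclePoly_eval_cos (s θ : ℝ) : ∀ n : ℕ,
    (semicirclePoly (s ^ 2) n).eval (2 * s * Real.cos θ) * Real.sin θ
      = s ^ n * Real.sin ((n + 1) * θ)
  | 0 => by simp [semicirclePoly]
  | 1 => by
    simp only [semicirclePoly, Polynomial.eval_X, Nat.cast_one, pow_one]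
    rw [show (1 + 1) * θ = 2 * θ by ring, Real.sin_two_mul]; ring
  | n + 2 => by
    have h0 := semicirclePoly_eval_cos s θ n
    have h1 := semicirclePoly_eval_cos s θ (n + 1)
    rw [semicirclePoly, Polynomial.eval_sub, Polynomial.eval_mul, Polynomial.eval_mul,
      Polynomial.eval_X, Polynomial.eval_C]
    push_cast at h1 ⊢
    have e1 : ((n : ℝ) + 2 + 1) * θ = ((n : ℝ) + 1 + 1) * θ + θ := by ring
    have e2 : ((n : ℝ) + 1) * θ = ((n : ℝ) + 1 + 1) * θ - θ := by ring
    rw [e2, Real.sin_sub] at h0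
    rw [e1, Real.sin_add]
    linear_combination 2 * s * Real.cos θ * h1 - s ^ 2 * h0

theorem integral_cos_natCast_mul {k : ℕ} (hk : k ≠ 0) :
    ∫ θ in (0 : ℝ)..Real.pi, Real.cos (k * θ) = 0 := by
  rw [intervalIntegral.integral_comp_mul_left _ (by exact_mod_cast hk), integral_cos]
  simp [Real.sin_nat_mul_pi]

theorem integral_sin_mul_sin (n : ℕ) :
    ∫ θ in (0 : ℝ)..Real.pi, Real.sin ((n + 1) * θ) * Real.sin θ
      = if n = 0 then Real.pi / 2 else 0 := by
  have e : ∀ θ : ℝ, Real.sin ((n + 1) * θ) * Real.sin θ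
      = (1 / 2) * (Real.cos (n * θ) - Real.cos ((n + 2 : ℕ) * θ)) := by
    intro θ
    have e1 : (n : ℝ) * θ = (n + 1) * θ - θ := by ring
    have e2 : ((n + 2 : ℕ) : ℝ) * θ = (n + 1) * θ + θ := by push_cast; ring
    rw [e1, e2, Real.cos_sub, Real.cos_add]; ring
  simp_rw [e]
  rw [intervalIntegral.integral_const_mul, intervalIntegral.integral_sub
    (Continuous.intervalIntegrable (by fun_prop) _ _)
    (Continuous.intervalIntegrable (by fun_prop) _ _),
    integral_cos_natCast_mul (k := n + 2) (by omega)]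
  split_ifs with h
  · subst h; simp; ring
  · rw [integral_cos_natCast_mul h]; simp

theorem integral_semicirclePoly {s : ℝ} (hs : 0 < s) (n : ℕ) :
    ∫ x, (semicirclePoly (s ^ 2) n).eval x ∂semicircle (2 * s) = if n = 0 then 1 else 0 := by
  rw [integral_semicircle_eq_integral_cos (by positivity) (Polynomial.continuous _)]
  simp_rw [semicirclePoly_eval_cos, mul_assoc]
  rw [intervalIntegral.integral_const_mul, integral_sin_mul_sin]
  have := Real.pi_pos.ne'
  split_ifs with h
  · subst h; field_simp
  · simp

theorem isProbabilityMeasure_of_integral_one {μ : Measure ℝ} (h : ∫ _, (1 : ℝ) ∂μ = 1) :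
    IsProbabilityMeasure μ := by
  simp only [integral_const, smul_eq_mul, mul_one] at h
  rw [measureReal_def] at h
  exact ⟨(ENNReal.toReal_eq_one_iff _).1 h⟩

theorem isProbabilityMeasure_semicircle {s : ℝ} (hs : 0 < s) :
    IsProbabilityMeasure (semicircle (2 * s)) := by
  refine isProbabilityMeasure_of_integral_one ?_
  simpa [semicirclePoly] using integral_semicirclePoly hs 0

/-- The cumulative distribution function of the semicircle distribution. -/
noncomputable def semicircleCDF (R x : ℝ) : ℝ := ∫ y in (-R)..x, semicircleDensity R y

theorem hasDerivAt_semicircleCDF (R x : ℝ) :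
    HasDerivAt (semicircleCDF R) (semicircleDensity R x) x :=
  (continuous_semicircleDensity R).integral_hasStrictDerivAt _ _ |>.hasDerivAt

theorem continuous_semicircleCDF (R : ℝ) : Continuous (semicircleCDF R) :=
  continuous_iff_continuousAt.2 fun x => (hasDerivAt_semicircleCDF R x).continuousAt

theorem semicircleCDF_right {s : ℝ} (hs : 0 < s) : semicircleCDF (2 * s) (2 * s) = 1 := by
  have h := integral_semicirclePoly hs 0
  rw [integral_semicircle (by positivity)] at h
  simpa [semicirclePoly, semicircleCDF] using h

/-- Probability integral transform: substituting the distribution function turns the semicircle law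
into Lebesgue measure on `[0, 1]`. -/
theorem integral_semicircleCDF_pow {s : ℝ} (hs : 0 < s) (t : ℝ) (k : ℕ) :
    ∫ x, (-t * semicircleCDF (2 * s) x) ^ k ∂semicircle (2 * s) = (-t) ^ k / (k + 1) := by
  rw [integral_semicircle (by positivity)]
  have hsub := intervalIntegral.integral_comp_mul_deriv (a := -(2 * s)) (b := 2 * s)
    (f := semicircleCDF (2 * s)) (f' := semicircleDensity (2 * s)) (g := fun u => (-t * u) ^ k)
    (fun x _ => hasDerivAt_semicircleCDF _ x) (continuous_semicircleDensity _).continuousOn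
    (by fun_prop)
  have h0 : semicircleCDF (2 * s) (-(2 * s)) = 0 := intervalIntegral.integral_same
  rw [semicircleCDF_right hs, h0] at hsub
  simp only [Function.comp_apply] at hsub
  simp_rw [mul_comm (semicircleDensity _ _)]
  rw [hsub]
  simp_rw [mul_pow]
  rw [intervalIntegral.integral_const_mul, integral_pow]
  simp [div_eq_mul_inv]

end Semicircle

/-! ### Moments of the uniform law. -/

section Uniform

variable {t : ℝ}

theorem integral_uniformInterval (ht : 0 < t) (f : ℝ → ℝ) :
    ∫ x, f x ∂uniformInterval (-t) 0 = t⁻¹ * ∫ x in (-t)..0, f x := by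
  rw [uniformInterval, ProbabilityTheory.cond, integral_smul_measure, Real.volume_Icc,
    intervalIntegral.integral_of_le (by linarith), integral_Icc_eq_integral_Ioc]
  simp [ht.le]

theorem integral_pow_uniformInterval (ht : 0 < t) (k : ℕ) :
    ∫ x, x ^ k ∂uniformInterval (-t) 0 = (-t) ^ k / (k + 1) := by
  rw [integral_uniformInterval ht, integral_pow]
  have hk : (k + 1 : ℝ) ≠ 0 := by exact_mod_cast k.succ_ne_zero
  rw [zero_pow k.succ_ne_zero, pow_succ]
  field_simp
  ring

theorem isProbabilityMeasure_uniformInterval (ht : 0 < t) :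
    IsProbabilityMeasure (uniformInterval (-t) 0) := by
  refine isProbabilityMeasure_of_integral_one ?_
  simpa using integral_pow_uniformInterval ht 0

theorem uniformInterval_compl_Icc : uniformInterval (-t) 0 (Set.Icc (-t) 0)ᶜ = 0 := by
  rw [uniformInterval, ProbabilityTheory.cond_apply measurableSet_Icc]
  simp

end Uniform

/-! ### Moments of any measure realizing the free convolution. -/

section Moments

variable {A : Type*} [Ring A] [Algebra ℂ A] {φ : A →ₗ[ℂ] ℂ} {a : A} {μ : Measure ℝ}

theorem IsDistribution.integrable (h : IsDistribution φ a μ) {f : ℝ → ℝ} (hf : Continuous f) :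
    Integrable f μ := by
  have := h.isProbabilityMeasure
  obtain ⟨K, hK, hμ⟩ := h.compactSupport
  exact integrable_of_isCompact_of_continuous hK hμ hf

theorem IsDistribution.momentFunctional_map (h : IsDistribution φ a μ) (p : Polynomial ℝ) :
    momentFunctional φ a (p.map Complex.ofRealHom) = ((∫ x, p.eval x ∂μ : ℝ) : ℂ) := by
  induction p using Polynomial.induction_on' with
  | add p q hp hq =>
    simp only [Polynomial.map_add, map_add, Polynomial.eval_add, hp, hq]
    rw [integral_add (h.integrable p.continuous) (h.integrable q.continuous)]
    push_cast; rfl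
  | monomial n c =>
    rw [Polynomial.map_monomial, ← Polynomial.C_mul_X_pow_eq_monomial,
      ← Polynomial.smul_eq_C_mul, map_smul, momentFunctional_X_pow, h.moment]
    simp only [Polynomial.eval_monomial, integral_const_mul]
    push_cast; rfl

/-- The moments of a measure that is a free additive convolution of a semicircle distribution
and a uniform distribution. -/
theorem IsFreeAdditiveConvolution.integral_pow {t : ℝ} (ht : 0 < t) {ρ : Measure ℝ}
    (hρ : IsFreeAdditiveConvolution (semicircle (2 * Real.sqrt t)) (uniformInterval (-t) 0) ρ)
    (n : ℕ) :
    Integrable (fun x : ℝ => x ^ n) ρ ∧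
      ∫ x, x ^ n ∂ρ = (n.factorial : ℝ) * ∑ j ∈ Finset.Icc ⌈(n : ℚ) / 2⌉₊ n,
        t ^ j / ((j.factorial : ℝ) * ((1 + j).factorial : ℝ)) *
          (signedStirlingFirst (1 + j) (n + 1 - j) : ℝ) := by
  obtain ⟨A, _, φ, a, b, hφ, -, -, hfree, ha, hb, hab⟩ := hρ
  refine ⟨hab.integrable (by fun_prop), ?_⟩
  have hs : Real.sqrt t ^ 2 = t := Real.sq_sqrt ht.le
  have key := hfree.moment_add hφ.map_one (t : ℂ) (fun k => ?_) (fun k => ?_) n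
  · rw [hab.moment] at key
    apply Complex.ofReal_injective
    rw [key]
    push_cast
    rfl
  · have h1 := ha.momentFunctional_map (semicirclePoly t k)
    have h2 := integral_semicirclePoly (Real.sqrt_pos.2 ht) k
    rw [hs] at h2
    rw [map_semicirclePoly, h2] at h1
    refine h1.trans ?_
    split_ifs <;> simp
  · rw [hb.moment, integral_pow_uniformInterval ht]
    push_cast
    rfl

end Moments

/-! ### The orthogonal polynomials span all polynomials. -/

section PolynomialSpan

theorem span_semicirclePoly {R : Type*} [CommRing R] (t : R) :
    Submodule.span R (Set.range (semicirclePoly t)) = ⊤ := by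
  set M := Submodule.span R (Set.range (semicirclePoly t)) with hM
  have hmem : ∀ n, semicirclePoly t n ∈ M := fun n => Submodule.subset_span ⟨n, rfl⟩
  have hX : ∀ p ∈ M, Polynomial.X * p ∈ M := by
    intro p hp
    induction hp using Submodule.span_induction with
    | mem p hp =>
      obtain ⟨n, rfl⟩ := hp
      rcases n with _ | n
      · simpa [semicirclePoly] using hmem 1
      · have e : Polynomial.X * semicirclePoly t (n + 1)
            = semicirclePoly t (n + 2) + t • semicirclePoly t n := by
          rw [semicirclePoly, Polynomial.smul_eq_C_mul]; ring
        rw [e]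
        exact M.add_mem (hmem _) (M.smul_mem _ (hmem _))
    | zero => rw [mul_zero]; exact M.zero_mem
    | add p q _ _ hp hq => rw [mul_add]; exact M.add_mem hp hq
    | smul c p _ hp => rw [mul_smul_comm]; exact M.smul_mem _ hp
  have hpow : ∀ n : ℕ, (Polynomial.X ^ n : Polynomial R) ∈ M := by
    intro n
    induction n with
    | zero => simpa [semicirclePoly] using hmem 0
    | succ n ih => rw [pow_succ']; exact hX _ ih
  refine eq_top_iff.2 fun p _ => ?_
  induction p using Polynomial.induction_on' with
  | add p q hp hq => exact M.add_mem (hp trivial) (hq trivial)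
  | monomial n c =>
    rw [← Polynomial.C_mul_X_pow_eq_monomial, ← Polynomial.smul_eq_C_mul]
    exact M.smul_mem _ (hpow n)

end PolynomialSpan

/-! ### Free semicircular operators on the full Fock space. -/

section Fock

/-- The full Fock space of a two-dimensional Hilbert space. -/
def FockSpace : Type := lp (fun _ : List Bool => ℂ) 2

noncomputable instance : NormedAddCommGroup FockSpace :=
  inferInstanceAs (NormedAddCommGroup (lp (fun _ : List Bool => ℂ) 2))

noncomputable instance : InnerProductSpace ℂ FockSpace :=
  inferInstanceAs (InnerProductSpace ℂ (lp (fun _ : List Bool => ℂ) 2))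

instance : CompleteSpace FockSpace :=
  inferInstanceAs (CompleteSpace (lp (fun _ : List Bool => ℂ) 2))

/-- The coordinates of a vector of the Fock space. -/
abbrev FockSpace.coord (f : lp (fun _ : List Bool => ℂ) 2) : List Bool → ℂ := f

instance : CoeFun FockSpace (fun _ => List Bool → ℂ) := ⟨fun f => FockSpace.coord f⟩

theorem FockSpace.ext {f g : FockSpace} (h : ∀ w, f w = g w) : f = g := lp.ext (funext h)

theorem FockSpace.smul_apply (c : ℂ) (f : FockSpace) (w : List Bool) : (c • f) w = c * f w := rfl

theorem FockSpace.inner_eq_tsum (f g : FockSpace) :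
    inner ℂ f g = ∑' w, inner ℂ (f w) (g w) := rfl

/-- The basis vector of the Fock space indexed by a word. -/
noncomputable def fockBasis (w : List Bool) : FockSpace :=
  (lp.single 2 w (1 : ℂ) : lp (fun _ : List Bool => ℂ) 2)

theorem inner_fockBasis (w : List Bool) (f : FockSpace) : inner ℂ (fockBasis w) f = f w := by
  have h : inner ℂ (fockBasis w) f = inner ℂ (1 : ℂ) (f w) :=
    lp.inner_single_left (𝕜 := ℂ) (G := fun _ : List Bool => ℂ) w (1 : ℂ) f
  rw [h]; simp

theorem fockBasis_apply (w v : List Bool) : fockBasis w v = if v = w then 1 else 0 := by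
  have h : fockBasis w v = Pi.single (M := fun _ : List Bool => ℂ) w (1 : ℂ) v :=
    lp.single_apply (E := fun _ : List Bool => ℂ) 2 w (1 : ℂ) v
  rw [h, Pi.single_apply]

theorem orthonormal_fockBasis : Orthonormal ℂ fockBasis := by
  rw [orthonormal_iff_ite]
  intro v w
  rw [inner_fockBasis, fockBasis_apply]

/-- The isometry that prepends the letter `i`. -/
noncomputable def creationIsometry (i : Bool) : FockSpace →ₗᵢ[ℂ] FockSpace :=
  ((orthonormal_fockBasis.comp (List.cons i) List.cons_injective).orthogonalFamily
    ).linearIsometry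

/-- The creation operator that prepends the letter `i`. -/
noncomputable def creation (i : Bool) : FockSpace →L[ℂ] FockSpace :=
  (creationIsometry i).toContinuousLinearMap

theorem creation_fockBasis (i : Bool) (w : List Bool) :
    creation i (fockBasis w) = fockBasis (i :: w) := by
  have := OrthogonalFamily.linearIsometry_apply_single
    (orthonormal_fockBasis.comp (List.cons i) List.cons_injective).orthogonalFamily
    (i := w) (1 : ℂ)
  refine this.trans ?_
  simp

theorem adjoint_creation_apply (i : Bool) (f : FockSpace) (w : List Bool) :
    (ContinuousLinearMap.adjoint (creation i) f) w = f (i :: w) := by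
  rw [← inner_fockBasis, ContinuousLinearMap.adjoint_inner_right, creation_fockBasis,
    inner_fockBasis]

/-- The semicircular element `s (ℓᵢ + ℓᵢ*)`. -/
noncomputable def semicircular (s : ℝ) (i : Bool) : FockSpace →L[ℂ] FockSpace :=
  (s : ℂ) • (creation i + star (creation i))

theorem isSelfAdjoint_semicircular (s : ℝ) (i : Bool) : IsSelfAdjoint (semicircular s i) := by
  rw [isSelfAdjoint_iff, semicircular, star_smul, star_add, star_star, add_comm]
  simp

theorem semicircular_fockBasis_of_head (s : ℝ) {i : Bool} {w : List Bool} (hw : w.head? ≠ some i) :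
    semicircular s i (fockBasis w) = (s : ℂ) • fockBasis (i :: w) := by
  have : star (creation i) (fockBasis w) = 0 := by
    refine FockSpace.ext fun v => ?_
    rw [ContinuousLinearMap.star_eq_adjoint, adjoint_creation_apply, fockBasis_apply, if_neg]
    · rfl
    · rintro rfl; simp at hw
  rw [semicircular, smul_apply, add_apply, creation_fockBasis, this, add_zero]

theorem semicircular_fockBasis_cons (s : ℝ) (i : Bool) (w : List Bool) :
    semicircular s i (fockBasis (i :: w))
      = (s : ℂ) • fockBasis (i :: i :: w) + (s : ℂ) • fockBasis w := by
  have : star (creation i) (fockBasis (i :: w)) = fockBasis w := by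
    refine FockSpace.ext fun v => ?_
    rw [ContinuousLinearMap.star_eq_adjoint, adjoint_creation_apply, fockBasis_apply,
      fockBasis_apply]
    simp
  rw [semicircular, smul_apply, add_apply, creation_fockBasis, this, smul_add]

/-- The subtracted term of the polynomial recurrence cancels exactly what annihilation produces, so
only the prepended letters remain. -/
theorem aeval_semicircular_fockBasis (s : ℝ) {i : Bool} {w : List Bool} (hw : w.head? ≠ some i) :
    ∀ n : ℕ, Polynomial.aeval (semicircular s i) (semicirclePoly ((s : ℂ) ^ 2) n) (fockBasis w)
      = (s : ℂ) ^ n • fockBasis (List.replicate n i ++ w)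
  | 0 => by simp [semicirclePoly]
  | 1 => by simp [semicirclePoly, semicircular_fockBasis_of_head s hw]
  | n + 2 => by
    have h0 := aeval_semicircular_fockBasis s hw n
    have h1 := aeval_semicircular_fockBasis s hw (n + 1)
    rw [semicirclePoly, map_sub, map_mul, map_mul, Polynomial.aeval_X, Polynomial.aeval_C,
      sub_apply, mul_apply_eq_comp, mul_apply_eq_comp,
      h0, h1, Algebra.algebraMap_eq_smul_one, map_smul, List.replicate_succ, List.cons_append,
      semicircular_fockBasis_cons, List.replicate_succ, List.replicate_succ, List.cons_append,
      List.cons_append, smul_apply, one_apply_eq_self]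
    module

/-- The matrix coefficients of an operator on the Fock space. -/
noncomputable def fockCoeff (v w : List Bool) : (FockSpace →L[ℂ] FockSpace) →L[ℂ] ℂ :=
  (innerSL ℂ (fockBasis v)).comp (ContinuousLinearMap.apply ℂ FockSpace (fockBasis w))

theorem fockCoeff_apply (v w : List Bool) (x : FockSpace →L[ℂ] FockSpace) :
    fockCoeff v w x = x (fockBasis w) v := by
  rw [← inner_fockBasis]; rfl

/-- The vacuum state. -/
noncomputable def vacuum : (FockSpace →L[ℂ] FockSpace) →ₗ[ℂ] ℂ := (fockCoeff [] []).toLinearMap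

theorem vacuum_apply (x : FockSpace →L[ℂ] FockSpace) : vacuum x = fockCoeff [] [] x := rfl

theorem isState_vacuum : IsState vacuum := by
  have key : ∀ x : FockSpace →L[ℂ] FockSpace,
      vacuum (star x * x) = ((‖x (fockBasis [])‖ ^ 2 : ℝ) : ℂ) := by
    intro x
    rw [vacuum_apply, fockCoeff_apply, ← inner_fockBasis, mul_apply_eq_comp,
      ContinuousLinearMap.star_eq_adjoint, ContinuousLinearMap.adjoint_inner_right,
      inner_self_eq_norm_sq_to_K]
    push_cast; rfl
  refine ⟨?_, fun x => ?_, fun x => ?_⟩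
  · rw [vacuum_apply, fockCoeff_apply, one_apply_eq_self, fockBasis_apply, if_pos rfl]
  · rw [key, Complex.ofReal_re]; positivity
  · rw [key, Complex.ofReal_im]

/-- The compression of `x` to the words that do not start with `i` is a multiple of the
identity. -/
def IsScalarOff (i : Bool) (x : FockSpace →L[ℂ] FockSpace) : Prop :=
  ∀ v w : List Bool, v.head? ≠ some i → w.head? ≠ some i →
    fockCoeff v w x = vacuum x * fockBasis w v

/-- For centred `x` the compression is zero, so `x` sends vectors supported off the words starting
with `i` to vectors supported on them. Passing to the adjoint writes the coordinate as a sum over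
words whose terms all vanish. -/
theorem IsScalarOff.apply_eq_zero {i : Bool} {x : FockSpace →L[ℂ] FockSpace}
    (hx : IsScalarOff i x) (h0 : vacuum x = 0) {f : FockSpace}
    (hf : ∀ w : List Bool, w.head? = some i → f w = 0) {v : List Bool} (hv : v.head? ≠ some i) :
    x f v = 0 := by
  rw [← inner_fockBasis, ← ContinuousLinearMap.adjoint_inner_left, FockSpace.inner_eq_tsum]
  refine (tsum_congr fun w => ?_).trans tsum_zero
  by_cases hw : w.head? = some i
  · rw [hf w hw, inner_zero_right]
  · have h1 : ContinuousLinearMap.adjoint x (fockBasis v) w = 0 := by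
      rw [← inner_fockBasis, ContinuousLinearMap.adjoint_inner_right, ← inner_conj_symm,
        inner_fockBasis, ← fockCoeff_apply, hx v w hv hw, h0, zero_mul, map_zero]
    rw [h1, inner_zero_left]

/-- Ping-pong from the right: each centred factor moves the vector onto words starting with its own
letter, and the next factor has the other letter. The final vector has no component on the empty
word. -/
theorem freeSubalgebras_of_isScalarOff {B : Bool → Subalgebra ℂ (FockSpace →L[ℂ] FockSpace)}
    (hB : ∀ i, ∀ x ∈ B i, IsScalarOff i x) : FreeSubalgebras vacuum B := by
  have key : ∀ (l : List (Bool × (FockSpace →L[ℂ] FockSpace))) (i : Bool)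
      (x : FockSpace →L[ℂ] FockSpace),
      ((i, x) :: l).IsChain (fun p q => p.1 ≠ q.1) →
      (∀ p ∈ (i, x) :: l, p.2 ∈ B p.1 ∧ vacuum p.2 = 0) → ∀ v : List Bool, v.head? ≠ some i →
      (((i, x) :: l).map Prod.snd).prod (fockBasis []) v = 0 := by
    intro l
    induction l with
    | nil =>
      intro i x _ h v hv
      obtain ⟨h1, h2⟩ := h (i, x) (by simp)
      simp only [List.map_cons, List.map_nil, List.prod_cons, List.prod_nil, mul_one]
      refine (hB i x h1).apply_eq_zero h2 (fun w hw => ?_) hv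
      rw [fockBasis_apply, if_neg]
      rintro rfl; simp at hw
    | cons q l ih =>
      obtain ⟨j, y⟩ := q
      intro i x hc h v hv
      obtain ⟨h1, h2⟩ := h (i, x) (by simp)
      obtain ⟨hij, hc⟩ := List.isChain_cons_cons.1 hc
      rw [List.map_cons, List.prod_cons, mul_apply_eq_comp]
      refine (hB i x h1).apply_eq_zero h2 (fun w hw => ?_) hv
      refine ih j y hc (fun p hp => h p (List.mem_cons_of_mem _ hp)) w ?_
      rw [hw]
      simpa using hij
  intro l hl hc h
  rcases l with _ | ⟨⟨i, x⟩, l⟩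
  · exact absurd rfl hl
  · rw [vacuum_apply, fockCoeff_apply]
    exact key l i x hc h [] (by simp)

/-- By linearity `p` may be an orthogonal polynomial. In positive degree it sends the basis vector
of `w` to a word starting with `i`, so both sides vanish. -/
theorem isScalarOff_aeval_semicircular (s : ℝ) (i : Bool) (p : Polynomial ℂ) :
    IsScalarOff i (Polynomial.aeval (semicircular s i) p) := by
  intro v w hv hw
  have hp : p ∈ Submodule.span ℂ (Set.range (semicirclePoly ((s : ℂ) ^ 2))) := by
    rw [span_semicirclePoly]; trivial
  induction hp using Submodule.span_induction with
  | mem p hp =>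
    obtain ⟨n, rfl⟩ := hp
    rw [vacuum_apply, fockCoeff_apply, fockCoeff_apply, aeval_semicircular_fockBasis s hw,
      aeval_semicircular_fockBasis s (i := i) (w := []) (by simp)]
    rcases n with _ | n
    · simp [fockBasis_apply]
    · have h1 : v ≠ List.replicate (n + 1) i ++ w := by
        rintro rfl; simp [List.replicate_succ] at hv
      have h2 : [] ≠ List.replicate (n + 1) i ++ ([] : List Bool) := by
        simp [List.replicate_succ]
      simp only [FockSpace.smul_apply, fockBasis_apply, if_neg h1, if_neg h2, mul_zero,
        zero_mul]
  | zero => simp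
  | add p q _ _ hp hq => rw [map_add, map_add, map_add, hp, hq, add_mul]
  | smul c p _ hp => rw [map_smul, map_smul, map_smul, hp, smul_eq_mul, smul_eq_mul, mul_assoc]

theorem vacuum_aeval_semicircular {s : ℝ} (hs : 0 < s) (i : Bool) (p : Polynomial ℝ) :
    vacuum (Polynomial.aeval (semicircular s i) p) = ((∫ x, p.eval x ∂semicircle (2 * s) : ℝ) : ℂ) := by
  have := isProbabilityMeasure_semicircle hs
  have hint : ∀ p : Polynomial ℝ, Integrable (fun x => p.eval x) (semicircle (2 * s)) := fun p =>
    integrable_of_isCompact_of_continuous isCompact_Icc (semicircle_compl_Icc (by positivity))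
      p.continuous
  have hp : p ∈ Submodule.span ℝ (Set.range (semicirclePoly (s ^ 2))) := by
    rw [span_semicirclePoly]; trivial
  induction hp using Submodule.span_induction with
  | mem p hp =>
    obtain ⟨n, rfl⟩ := hp
    rw [integral_semicirclePoly hs, ← Polynomial.aeval_map_algebraMap ℂ, map_semicirclePoly,
      map_pow, Complex.coe_algebraMap, vacuum_apply, fockCoeff_apply,
      aeval_semicircular_fockBasis s (i := i) (w := []) (by simp)]
    rcases n with _ | n
    · simp [fockBasis_apply]
    · rw [FockSpace.smul_apply, fockBasis_apply, if_neg (by simp [List.replicate_succ])]; simp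
  | zero => simp
  | add p q _ _ hp hq =>
    simp only [map_add, hp, hq, Polynomial.eval_add]
    rw [integral_add (hint p) (hint q), Complex.ofReal_add]
  | smul c p _ hp =>
    simp only [map_smul, Polynomial.eval_smul, smul_eq_mul, integral_const_mul]
    rw [← Complex.coe_smul, map_smul, hp]
    simp

end Fock

/-! ### Passage to continuous functions and construction of the free pair. -/

section FunctionalCalculus

theorem exists_polynomial_near_cfc {A : Type*} [CStarAlgebra A] {a : A} (ha : IsSelfAdjoint a)
    {f : ℝ → ℝ} (hf : Continuous f) (r : ℝ) {ε : ℝ} (hε : 0 < ε) :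
    ∃ p : Polynomial ℝ, (∀ x ∈ Set.Icc (-r) r, |f x - p.eval x| ≤ ε) ∧
      ‖cfc f a - Polynomial.aeval a p‖ ≤ ε := by
  -- The interval covers both `[-r, r]` and the spectrum, so a single Weierstrass approximant serves
  -- the integral and the operator.
  set R := max r (‖a‖ * ‖(1 : A)‖) with hR
  obtain ⟨p, hp⟩ := exists_polynomial_near_of_continuousOn (-R) R f hf.continuousOn ε hε
  have hp' : ∀ x, |x| ≤ R → |f x - p.eval x| ≤ ε := fun x hx => by
    rw [abs_sub_comm]; exact (hp x (abs_le.1 hx)).le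
  refine ⟨p, fun x hx => hp' x ((abs_le.2 hx).trans (le_max_left _ _)), ?_⟩
  rw [← cfc_polynomial p a, ← cfc_sub f p.eval a hf.continuousOn p.continuous.continuousOn]
  refine norm_cfc_le hε.le fun x hx => hp' x ?_
  exact (spectrum.norm_le_norm_mul_of_mem hx).trans (le_max_right _ _)

theorem IsScalarOff.cfc_semicircular (s : ℝ) (i : Bool) {f : ℝ → ℝ} (hf : Continuous f) :
    IsScalarOff i (cfc f (semicircular s i)) := by
  intro v w hv hw
  -- The claim is the vanishing of this continuous functional, which is known on polynomials in the
  -- operator and extends by approximation.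
  set Ψ : (FockSpace →L[ℂ] FockSpace) →L[ℂ] ℂ :=
    fockCoeff v w - (fockBasis w v) • fockCoeff [] [] with hΨ
  have hΨp : ∀ p : Polynomial ℝ, Ψ (Polynomial.aeval (semicircular s i) p) = 0 := by
    intro p
    have := isScalarOff_aeval_semicircular s i (p.map (algebraMap ℝ ℂ)) v w hv hw
    rw [Polynomial.aeval_map_algebraMap, vacuum_apply] at this
    simp [hΨ, this, mul_comm]
  have h0 : ‖Ψ (cfc f (semicircular s i))‖ ≤ 0 := by
    refine le_of_forall_pos_le_add fun ε hε => ?_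
    have hδ : 0 < ε / (‖Ψ‖ + 1) := by positivity
    obtain ⟨p, -, hp⟩ := exists_polynomial_near_cfc (isSelfAdjoint_semicircular s i) hf 0 hδ
    have := Ψ.le_opNorm (cfc f (semicircular s i) - Polynomial.aeval (semicircular s i) p)
    rw [map_sub, hΨp, sub_zero] at this
    calc _ ≤ _ := this
      _ ≤ (‖Ψ‖ + 1) * (ε / (‖Ψ‖ + 1)) := by gcongr; linarith
      _ = 0 + ε := by rw [zero_add]; field_simp
  have h1 : Ψ (cfc f (semicircular s i)) = 0 := norm_le_zero_iff.1 h0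
  rw [hΨ, sub_apply, sub_eq_zero] at h1
  rw [h1, vacuum_apply, smul_apply, smul_eq_mul, mul_comm]

theorem vacuum_cfc_semicircular {s : ℝ} (hs : 0 < s) (i : Bool) {f : ℝ → ℝ} (hf : Continuous f) :
    vacuum (cfc f (semicircular s i)) = ((∫ x, f x ∂semicircle (2 * s) : ℝ) : ℂ) := by
  have := isProbabilityMeasure_semicircle hs
  have hint : ∀ g : ℝ → ℝ, Continuous g → Integrable g (semicircle (2 * s)) := fun g hg =>
    integrable_of_isCompact_of_continuous isCompact_Icc (semicircle_compl_Icc (by positivity)) hg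
  set N := ‖fockCoeff [] []‖
  have h0 : ‖vacuum (cfc f (semicircular s i)) - ((∫ x, f x ∂semicircle (2 * s) : ℝ) : ℂ)‖ ≤ 0 := by
    refine le_of_forall_pos_le_add fun ε hε => ?_
    have hδ : 0 < ε / (N + 1) := by positivity
    obtain ⟨p, hp1, hp2⟩ :=
      exists_polynomial_near_cfc (isSelfAdjoint_semicircular s i) hf (2 * s) hδ
    have hae : ∀ᵐ x ∂semicircle (2 * s), x ∈ Set.Icc (-(2 * s)) (2 * s) := by
      rw [ae_iff]; exact semicircle_compl_Icc (by positivity)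
    have h1 : ‖∫ x, (f x - p.eval x) ∂semicircle (2 * s)‖ ≤ ε / (N + 1) := by
      have := norm_integral_le_of_norm_le_const (μ := semicircle (2 * s))
        (f := fun x => f x - p.eval x) (C := ε / (N + 1)) (by
          filter_upwards [hae] with x hx using hp1 x hx)
      simpa using this
    have h2 : ‖fockCoeff [] [] (cfc f (semicircular s i) - Polynomial.aeval (semicircular s i) p)‖
        ≤ N * (ε / (N + 1)) :=
      (ContinuousLinearMap.le_opNorm _ _).trans (by gcongr)
    have e : vacuum (cfc f (semicircular s i)) - ((∫ x, f x ∂semicircle (2 * s) : ℝ) : ℂ)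
        = fockCoeff [] [] (cfc f (semicircular s i) - Polynomial.aeval (semicircular s i) p)
          - ((∫ x, (f x - p.eval x) ∂semicircle (2 * s) : ℝ) : ℂ) := by
      rw [integral_sub (hint f hf) (hint _ p.continuous), map_sub, ← vacuum_apply, ← vacuum_apply,
        vacuum_aeval_semicircular hs]
      push_cast; ring
    rw [e]
    refine (norm_sub_le _ _).trans ?_
    rw [Complex.norm_real]
    calc _ ≤ N * (ε / (N + 1)) + ε / (N + 1) := add_le_add h2 h1
      _ = 0 + ε := by
        have hN : N + 1 ≠ 0 := by positivity
        rw [zero_add]; field_simp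
  exact sub_eq_zero.1 (norm_le_zero_iff.1 h0)

theorem IsScalarOff.of_mem_adjoin (s : ℝ) (i : Bool) {f : ℝ → ℝ} (hf : Continuous f)
    {x : FockSpace →L[ℂ] FockSpace} (hx : x ∈ Algebra.adjoin ℂ {cfc f (semicircular s i)}) :
    IsScalarOff i x := by
  rw [Algebra.adjoin_singleton_eq_range_aeval] at hx
  obtain ⟨p, rfl⟩ := hx
  intro v w hv hw
  induction p using Polynomial.induction_on' with
  | add p q hp hq =>
    simp only [AlgHom.toRingHom_eq_coe, RingHom.coe_coe, map_add] at hp hq ⊢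
    rw [hp, hq, add_mul]
  | monomial n c =>
    simp only [AlgHom.toRingHom_eq_coe, RingHom.coe_coe, Polynomial.aeval_monomial,
      ← Algebra.smul_def, map_smul, smul_eq_mul]
    rw [← cfc_pow f n (semicircular s i) hf.continuousOn (isSelfAdjoint_semicircular s i),
      IsScalarOff.cfc_semicircular s i (f := fun x => f x ^ n) (hf.pow n) v w hv hw, mul_assoc]

theorem isDistribution_cfc_semicircular {s : ℝ} (hs : 0 < s) (i : Bool) {f : ℝ → ℝ}
    (hf : Continuous f) {μ : Measure ℝ} (hμ : IsProbabilityMeasure μ)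
    (hcomp : ∃ K : Set ℝ, IsCompact K ∧ μ Kᶜ = 0)
    (hmom : ∀ k : ℕ, ∫ x, f x ^ k ∂semicircle (2 * s) = ∫ x, x ^ k ∂μ) :
    IsDistribution vacuum (cfc f (semicircular s i)) μ := by
  refine ⟨hμ, hcomp, fun k => ?_⟩
  rw [← cfc_pow f k (semicircular s i) hf.continuousOn (isSelfAdjoint_semicircular s i),
    vacuum_cfc_semicircular hs i (f := fun x => f x ^ k) (hf.pow k), hmom]

theorem exists_isFreeAdditiveConvolution {t : ℝ} (ht : 0 < t) :
    ∃ ρ : Measure ℝ, IsFreeAdditiveConvolution (semicircle (2 * Real.sqrt t))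
      (uniformInterval (-t) 0) ρ := by
  set s := Real.sqrt t
  have hs : 0 < s := Real.sqrt_pos.2 ht
  set F : ℝ → ℝ := fun x => -t * semicircleCDF (2 * s) x with hF
  have hFc : Continuous F := (continuous_semicircleCDF _).const_mul _
  -- Written as a functional calculus so that the same lemmas treat `a` and `b`.
  set a := cfc (id : ℝ → ℝ) (semicircular s true)
  set b := cfc F (semicircular s false)
  have ha : IsSelfAdjoint a := cfc_predicate _ _
  have hb : IsSelfAdjoint b := cfc_predicate _ _
  obtain ⟨ρ, hρ⟩ := isState_vacuum.exists_isDistribution (ha.add hb)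
  refine ⟨ρ, FockSpace →L[ℂ] FockSpace, inferInstance, vacuum, a, b, isState_vacuum, ha, hb,
    ?_, ?_, ?_, hρ⟩
  · refine freeSubalgebras_of_isScalarOff fun i x hx => ?_
    rcases i with _ | _
    · exact IsScalarOff.of_mem_adjoin s false hFc (by simpa using hx)
    · exact IsScalarOff.of_mem_adjoin s true continuous_id (by simpa using hx)
  · exact isDistribution_cfc_semicircular hs true continuous_id
      (isProbabilityMeasure_semicircle hs)
      ⟨_, isCompact_Icc, semicircle_compl_Icc (by positivity)⟩ fun k => rfl
  · refine isDistribution_cfc_semicircular hs false hFc (isProbabilityMeasure_uniformInterval ht)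
      ⟨_, isCompact_Icc, uniformInterval_compl_Icc⟩ fun k => ?_
    rw [integral_pow_uniformInterval ht, hF, integral_semicircleCDF_pow hs]

end FunctionalCalculus

end FreeProbability

theorem theorem2 (n : ℕ) (t : ℝ) (ht : 0 < t) :
    MeasureTheory.Integrable (fun x : ℝ => x ^ n)
        (FreeProbability.freeAdditiveConvolution
          (FreeProbability.semicircle (2 * Real.sqrt t))
          (FreeProbability.uniformInterval (-t) 0)) ∧
      ∫ x : ℝ, x ^ n ∂(FreeProbability.freeAdditiveConvolution
          (FreeProbability.semicircle (2 * Real.sqrt t))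
          (FreeProbability.uniformInterval (-t) 0)) =
        (n.factorial : ℝ) * ∑ j ∈ Finset.Icc ⌈(n : ℚ) / 2⌉₊ n,
          t ^ j / ((j.factorial : ℝ) * ((1 + j).factorial : ℝ)) *
            (FreeProbability.signedStirlingFirst (1 + j) (n + 1 - j) : ℝ) := by
  have hex := FreeProbability.exists_isFreeAdditiveConvolution ht
  have hρ : FreeProbability.IsFreeAdditiveConvolution
      (FreeProbability.semicircle (2 * Real.sqrt t)) (FreeProbability.uniformInterval (-t) 0)
      (FreeProbability.freeAdditiveConvolution (FreeProbability.semicircle (2 * Real.sqrt t))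
        (FreeProbability.uniformInterval (-t) 0)) := by
    rw [FreeProbability.freeAdditiveConvolution, dif_pos hex]
    -- Whichever measure is chosen, its moments are forced by the defining property.
    exact hex.choose_spec
  exact hρ.integral_pow ht n
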